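/- **Corollary (Poincaré duality).** Let $K$ be a closed polytopal $d$-mesh with a compatible orientation, $(C_\bullet K,\partial)$ its real cellular chain complex, $(C^\bullet K,\delta)$ the dual cochain complex and $[K]=\sum_{c\in K_d}c$ its fundamental class. (A mesh is a finite set of polytopes in a finite-dimensional real affine space, containing all faces of its members, in which two cells intersect in a possibly empty union of common faces; a $d$-polytope is a subset homeomorphic to a closed $d$-ball, with $d$-dimensional affine hull, whose boundary is a finite union of $(d-1)$-polytopes, its hyperfaces. A $d$-mesh is closed if every cell is a face of a $d$-cell, every $(d-1)$-cell is a face of exactly two $d$-cells, and for every cell $a$ of dimension $p\le d-2$ any two $(p+2)$-cells containing $a$ as a face are joined by a sequence of such cells in which consecutive ones share a $(p+1)$-cell having $a$ as a face. An orientation is compatible if the two $d$-cells at each $(d-1)$-cell induce opposite orientations on it.) Let $\smile$ be a cup product on $K$, that is, bilinear maps $C^pK\times C^qK\to C^{p+q}K$ such that $a^p\smile b^q\neq 0$ for basis cochains only if $a_p,b_q$ are faces of a common $(p+q)$-cell, $\delta(\sigma^p\smile\tau)=\delta\sigma^p\smile\tau+(-1)^p\sigma^p\smile\delta\tau$, and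 the $0$-cochain with value $1$ on all positively oriented nodes (and $-1$ on negatively oriented ones, if any) is a two-sided unit. Assume that $\smile$ is non-degenerate on cohomology level: for all $p$ the pairing $([\sigma],[\tau])\mapsto(\sigma\smile\tau)[K]$ on $H^{d-p}(C^\bullet K,\delta)\times H^p(C^\bullet K,\delta)$ is non-degenerate. Then for $0\le p\le d$ $$H^p(C^\bullet K,\delta)\cong H_{d-p}(C_\bullet K,\partial).$$ Moreover, $H^{d-p}(C^\bullet K,\delta)\cong H_{d-p}(C_\bullet K,\partial)$, and for every choice of inner products on the spaces $C^rK$, with adjoint coboundary $\delta^\star$, Laplacians $\Delta_r=\delta^{r-1}\delta^\star_r+\delta^\star_{r+1}\delta^r$ and Hodge star $\star_p\colon C^pK\to C^{d-p}K$ given by $\langle\sigma,\star_p\tau\rangle=(\sigma\smile\tau)[K]$: every harmonic cochain is closed and $\tau\mapsto[\tau]$ is an isomorphism $\operatorname{Ker}\Delta_r\to H^r(C^\bullet K,\delta)$ for all $r$; and $\star_p$ followed by the orthogonal projection onto $\operatorname{Ker}\Delta_{d-p}$ restricts to an isomorphism $\operatorname{Ker}\Delta_p\to\operatorname{Ker}\Delta_{d-p}$.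 -/

import Mathlib

open scoped Topology

noncomputable section

namespace Polytopal

/-! ### Subquotients of a vector space -/

section Subquotient

variable {W : Type*} [AddCommGroup W] [Module ℝ W]

/-- The quotient `Z / B` of subspaces of a vector space (`Z / (B ∩ Z)` if `B` is not contained
in `Z`). -/
def Subquotient (Z B : Submodule ℝ W) : Type _ := Z ⧸ B.submoduleOf Z

instance (Z B : Submodule ℝ W) : AddCommGroup (Subquotient Z B) :=
  inferInstanceAs (AddCommGroup (Z ⧸ B.submoduleOf Z))

instance (Z B : Submodule ℝ W) : Module ℝ (Subquotient Z B) :=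
  inferInstanceAs (Module ℝ (Z ⧸ B.submoduleOf Z))

/-- The class map `Z → Z / B`. -/
def Subquotient.mk (Z B : Submodule ℝ W) : Z →ₗ[ℝ] Subquotient Z B := (B.submoduleOf Z).mkQ

end Subquotient

/-! ### Meshes of (not necessarily convex) flat polytopes in an affine space -/

section Geometry

variable {V P : Type*} [NormedAddCommGroup V] [NormedSpace ℝ V]
  [MetricSpace P] [NormedAddTorsor V P]

/-- The dimension of the affine hull of `X`. -/
def dim (X : Set P) : ℕ := Module.finrank ℝ (vectorSpan ℝ X)

/-- `Y` and `X` belong to the collection `S` and `Y` is a hyperface of `X`: it has dimension one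
less and it is contained in the boundary of `X` relative to the affine hull of `X`. -/
def IsHyperface (S : Set (Set P)) (Y X : Set P) : Prop :=
  Y ∈ S ∧ X ∈ S ∧ dim Y + 1 = dim X ∧ Y ⊆ intrinsicFrontier ℝ X

/-- `Y ⪯ X`: `Y` is equal to `X` or it is a (proper) face of `X`, i.e. a hyperface of a hyperface
of ... of `X`. -/
def IsFace (S : Set (Set P)) : Set P → Set P → Prop :=
  Relation.ReflTransGen (IsHyperface S)

/-- `X` is homeomorphic to a closed ball of dimension `dim X` (so it is flat), in such a way that
the sphere bounding the ball corresponds to the boundary of `X` in its affine hull. -/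
def IsFlatBall (X : Set P) : Prop :=
  ∃ h : X ≃ₜ Metric.closedBall (0 : EuclideanSpace ℝ (Fin (dim X))) 1,
    ∀ x : X, (x : P) ∈ intrinsicFrontier ℝ X ↔ ‖(h x : EuclideanSpace ℝ (Fin (dim X)))‖ = 1

variable (P) in
/-- A polytopal mesh. By induction on the dimension every cell is a polytope: a `0`-cell is a
single point, a `d`-cell is a topological `d`-ball with `d`-dimensional affine hull whose boundary
is the union of finitely many `(d - 1)`-dimensional polytopes, its hyperfaces, which are cells of
the mesh as well (so that all faces of a cell are cells). The intersection of two
cells is a (possibly empty) union of common faces. -/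
structure Mesh where
  /-- the cells -/
  cells : Set (Set P)
  finite_cells : cells.Finite
  isFlatBall : ∀ X ∈ cells, IsFlatBall X
  boundary_eq : ∀ X ∈ cells, intrinsicFrontier ℝ X = ⋃₀ {Y | IsHyperface cells Y X}
  inter_eq : ∀ X ∈ cells, ∀ Y ∈ cells,
    X ∩ Y = ⋃₀ {Z | IsFace cells Z X ∧ IsFace cells Z Y}

namespace Mesh

variable (K : Mesh P)

/-- `K.Cell p` is the set `K_p` of `p`-cells. -/
def Cell (p : ℕ) : Type _ := {X : Set P // X ∈ K.cells ∧ dim X = p}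

variable {K} in
/-- The underlying set of a cell. -/
def Cell.carrier {p : ℕ} (c : K.Cell p) : Set P := c.1

instance (p : ℕ) : Finite (K.Cell p) :=
  (K.finite_cells.subset (fun _ hX => hX.1 : {X | X ∈ K.cells ∧ dim X = p} ⊆ K.cells)).to_subtype

instance (p : ℕ) : Fintype (K.Cell p) := Fintype.ofFinite _

variable {K} in
/-- `a ⪯ b` for cells. -/
def Cell.Face {p q : ℕ} (a : K.Cell p) (b : K.Cell q) : Prop :=
  IsFace K.cells a.carrier b.carrier

variable {K} in
/-- `b` is a hyperface of `c`. -/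
def Cell.Hyperface {p q : ℕ} (b : K.Cell p) (c : K.Cell q) : Prop :=
  IsHyperface K.cells b.carrier c.carrier

variable {K} in
theorem Cell.Hyperface.subset {p q : ℕ} {b : K.Cell p} {c : K.Cell q} (h : b.Hyperface c) :
    b.carrier ⊆ c.carrier := by
  obtain ⟨-, hc, -, hbc⟩ := h
  obtain ⟨e, -⟩ := K.isFlatBall _ hc
  have : CompactSpace c.carrier := e.symm.compactSpace
  have hcl : IsClosed c.carrier := (isCompact_iff_compactSpace.2 this).isClosed
  exact hbc.trans (intrinsicFrontier_subset hcl)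

/-- `K` is nonempty and `d` is the maximal dimension of its cells. -/
def IsDimension (d : ℕ) : Prop :=
  Nonempty (K.Cell d) ∧ ∀ X ∈ K.cells, dim X ≤ d

variable {K} in
/-- Two `(p + 2)`-superfaces `c`, `c'` of the `p`-cell `a` have a common `(p + 1)`-cell which is a
superface of `a` as well. -/
def AdjacentAround {p : ℕ} (a : K.Cell p) (c c' : K.Cell (p + 2)) : Prop :=
  a.Face c ∧ a.Face c' ∧ ∃ b : K.Cell (p + 1), a.Face b ∧ b.Face c ∧ b.Face c'

/-- Any two `(p + 2)`-superfaces of a `p`-cell `a` are joined by a sequence of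
`(p + 2)`-superfaces of `a` in which consecutive ones share a `(p + 1)`-cell around `a`. -/
def IsRegular (p : ℕ) : Prop :=
  ∀ (a : K.Cell p) (c c' : K.Cell (p + 2)), a.Face c → a.Face c' →
    Relation.ReflTransGen (AdjacentAround a) c c'

/-- Manifold-like `d`-dimensional meshes. -/
structure IsManifoldLike (d : ℕ) : Prop where
  isDimension : K.IsDimension d
  exists_top : ∀ p, p < d → ∀ b : K.Cell p, ∃ c : K.Cell d, b.Face c
  at_most_two : ∀ p, p + 1 = d → ∀ b : K.Cell p, {c : K.Cell d | b.Face c}.ncard ≤ 2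
  regular : ∀ p, p + 2 ≤ d → K.IsRegular p

/-- The boundary `∂K` of a `d`-dimensional mesh: all `(d - 1)`-cells with exactly one
`d`-superface, and the faces of these cells. It is empty if `d = 0`. -/
def boundary (d : ℕ) : Set (Set P) :=
  {X | ∃ (p : ℕ) (_ : p + 1 = d) (b : K.Cell p),
    {c : K.Cell d | b.Face c}.ncard = 1 ∧ IsFace K.cells X b.carrier}

/-- Closed `d`-dimensional meshes. -/
structure IsClosedMesh (d : ℕ) : Prop extends K.IsManifoldLike d where
  boundary_eq_empty : K.boundary d = ∅

end Mesh

/-- `v` is a vector in the direction of the affine hull of `c`, pointing out of `c` along `b`: near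
each relative interior point of `b`, moving along `v` leaves `c` and moving along `-v` enters the
relative interior of `c`. -/
def IsOutward (c b : Set P) (v : vectorSpan ℝ c) : Prop :=
  (v : V) ∉ vectorSpan ℝ b ∧
  ∀ x ∈ intrinsicInterior ℝ b, ∀ᶠ t in 𝓝[>] (0 : ℝ),
    (t • (v : V)) +ᵥ x ∉ c ∧ (-(t • (v : V))) +ᵥ x ∈ intrinsicInterior ℝ c

/-- An orientation of all cells of the mesh. An orientation of a `p`-cell is an orientation of the
direction space of its affine hull, i.e. a nonzero alternating `p`-form up to positive factors (for
`p = 0` there are two of them, the signs). -/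
structure Orient (K : Mesh P) where
  /-- the orientation of a cell -/
  or : ∀ {p : ℕ} (c : K.Cell p), Orientation ℝ (vectorSpan ℝ c.carrier) (Fin p)

variable {K : Mesh P} (o : Orient K)

namespace Orient

open Classical in
/-- The relative orientation `ε(c, b) = [n] ∧ or(b) / or(c)` of a hyperface `b` of `c`, where `n`
is outward-pointing. In terms of a form `ω` representing `or(c)`: it is `1` if the
contraction `ω(n, ·, …, ·)` represents `or(b)` on the direction space of `b`, and `-1` otherwise.
It is set to `0` if `b` is not a hyperface of `c`. -/
def relOr {p : ℕ} (c : K.Cell (p + 1)) (b : K.Cell p) : ℝ :=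
  if h : b.Hyperface c then
    if ∃ (n : vectorSpan ℝ c.carrier)
        (ω : vectorSpan ℝ c.carrier [⋀^Fin (p + 1)]→ₗ[ℝ] ℝ) (hω : ω ≠ 0)
        (hη : (ω.curryLeft n).compLinearMap
          (Submodule.inclusion (vectorSpan_mono ℝ h.subset)) ≠ 0),
        IsOutward c.carrier b.carrier n ∧ rayOfNeZero ℝ ω hω = o.or c ∧
          rayOfNeZero ℝ _ hη = o.or b
    then 1 else -1
  else 0

/-- The orientation is compatible: the two `d`-superfaces of an interior `(d - 1)`-cell induce
opposite orientations on it. -/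
def IsCompatible (d : ℕ) : Prop :=
  ∀ (p : ℕ) (_ : p + 1 = d) (a : K.Cell p) (b c : K.Cell (p + 1)),
    a.Hyperface b → a.Hyperface c → b ≠ c → o.relOr b a = - o.relOr c a

end Orient

/-! ### Chains, cochains, homology and cohomology -/

/-- `p`-chains: the free real vector space on the `p`-cells. -/
abbrev Mesh.Chain (K : Mesh P) (p : ℕ) : Type _ := K.Cell p →₀ ℝ

/-- `p`-cochains: the dual space of the space of `p`-chains. -/
abbrev Mesh.Cochain (K : Mesh P) (p : ℕ) : Type _ := Module.Dual ℝ (K.Chain p)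

/-- The basis cochain `c^p` dual to the cell `c_p`. -/
def Mesh.Cell.cochain {p : ℕ} (c : K.Cell p) : K.Cochain p := Finsupp.lapply c

/-- The chain `∑ c` over all `d`-cells; the fundamental class `[K]` if `K` is a compatibly
oriented `d`-dimensional mesh. -/
def Mesh.fundamentalClass (K : Mesh P) (d : ℕ) : K.Chain d := ∑ c : K.Cell d, Finsupp.single c 1

namespace Orient

/-- The boundary operator `∂_{p+1} : C_{p+1} K → C_p K`. -/
def bd (p : ℕ) : K.Chain (p + 1) →ₗ[ℝ] K.Chain p :=
  Finsupp.linearCombination ℝ fun c => ∑ b : K.Cell p, Finsupp.single b (o.relOr c b)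

/-- The coboundary operator `δ^p : C^p K → C^{p+1} K`, dual to `∂_{p+1}`. -/
def cobd (p : ℕ) : K.Cochain p →ₗ[ℝ] K.Cochain (p + 1) := (o.bd p).dualMap

/-- `Ker ∂_p`. -/
def cycles : (p : ℕ) → Submodule ℝ (K.Chain p)
  | 0 => ⊤
  | p + 1 => LinearMap.ker (o.bd p)

/-- `Im ∂_{p+1}`. -/
def boundaries (p : ℕ) : Submodule ℝ (K.Chain p) := LinearMap.range (o.bd p)

/-- `Ker δ^p`. -/
def cocycles (p : ℕ) : Submodule ℝ (K.Cochain p) := LinearMap.ker (o.cobd p)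

/-- `Im δ^{p-1}`. -/
def coboundaries : (p : ℕ) → Submodule ℝ (K.Cochain p)
  | 0 => ⊥
  | p + 1 => LinearMap.range (o.cobd p)

/-- `H_p(C_• K, ∂) = Ker ∂_p / Im ∂_{p+1}`. -/
abbrev Homology (p : ℕ) : Type _ := Subquotient (o.cycles p) (o.boundaries p)

/-- `H^p(C^• K, δ) = Ker δ^p / Im δ^{p-1}`. -/
abbrev Cohomology (p : ℕ) : Type _ := Subquotient (o.cocycles p) (o.coboundaries p)

open Classical in
/-- The unit `0`-cochain, with value `1` on the positively oriented `0`-cells (and `-1` on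
negatively oriented ones, if there are any). -/
def one : K.Cochain 0 :=
  ∑ a : K.Cell 0, (if o.or a = Module.Oriented.positiveOrientation then (1 : ℝ) else -1) • a.cochain

end Orient

/-! ### Cup products -/

/-- A cup product on the cochains of an oriented mesh: a bilinear product which is local, satisfies
the Leibniz rule, and has the unit cochain as a unit. (`cup p q n h` is the product
`C^p K × C^q K → C^n K`, where `n = p + q`.) Neither associativity nor graded commutativity
is required. -/
structure CupProduct where
  /-- the product of a `p`-cochain and a `q`-cochain -/
  cup : ∀ p q n : ℕ, p + q = n → K.Cochain p →ₗ[ℝ] K.Cochain q →ₗ[ℝ] K.Cochain n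
  isLocal : ∀ (p q n : ℕ) (h : p + q = n) (a : K.Cell p) (b : K.Cell q),
    cup p q n h a.cochain b.cochain ≠ 0 → ∃ c : K.Cell n, a.Face c ∧ b.Face c
  leibniz : ∀ (p q n : ℕ) (h : p + q = n) (σ : K.Cochain p) (τ : K.Cochain q),
    o.cobd n (cup p q n h σ τ) =
      cup (p + 1) q (n + 1) (by omega) (o.cobd p σ) τ +
        (-1 : ℝ) ^ p • cup p (q + 1) (n + 1) (by omega) σ (o.cobd q τ)
  one_cup : ∀ (p : ℕ) (σ : K.Cochain p), cup 0 p p (zero_add p) o.one σ = σ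
  cup_one : ∀ (p : ℕ) (σ : K.Cochain p), cup p 0 p (add_zero p) σ o.one = σ

namespace CupProduct

variable {o} (S : CupProduct o)

/-- The bilinear pairing `(σ, τ) ↦ (σ ⌣ τ)[K]` on `C^q K × C^p K`, where `q + p = d`. -/
def pairing {q p d : ℕ} (h : q + p = d) : K.Cochain q →ₗ[ℝ] K.Cochain p →ₗ[ℝ] ℝ :=
  (S.cup q p d h).compr₂ (Module.Dual.eval ℝ (K.Chain d) (K.fundamentalClass d))

/-- The cup product is non-degenerate on cohomology level: in complementary degrees, a class `[τ]`
with `([σ] ⌣ [τ])[K] = 0` for all classes `[σ]` vanishes, and likewise for `[σ]`. (The classes are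
written through their representatives.) -/
def NondegenerateOnCohomology (d : ℕ) : Prop :=
  ∀ (q p : ℕ) (h : q + p = d),
    (∀ τ ∈ o.cocycles p, (∀ σ ∈ o.cocycles q, S.pairing h σ τ = 0) → τ ∈ o.coboundaries p) ∧
    (∀ σ ∈ o.cocycles q, (∀ τ ∈ o.cocycles p, S.pairing h σ τ = 0) → σ ∈ o.coboundaries q)

end CupProduct

/-! ### Inner products, harmonic cochains and the Hodge star -/

variable (K) in
/-- A choice of an inner product on each space of cochains. -/
structure CochainInner where
  /-- the inner product of `p`-cochains -/
  inner : ∀ p : ℕ, LinearMap.BilinForm ℝ (K.Cochain p)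
  symm : ∀ (p : ℕ) (σ τ : K.Cochain p), inner p σ τ = inner p τ σ
  pos : ∀ (p : ℕ) (σ : K.Cochain p), σ ≠ 0 → 0 < inner p σ σ

namespace CochainInner

variable (g : CochainInner K)

theorem nondegenerate (p : ℕ) : (g.inner p).Nondegenerate := by
  constructor
  · intro σ h
    by_contra hσ
    exact (g.pos p σ hσ).ne' (h σ)
  · intro σ h
    by_contra hσ
    exact (g.pos p σ hσ).ne' (h σ)

/-- The Riesz isomorphism `σ ↦ ⟨σ, ·⟩`. -/
def riesz (p : ℕ) : K.Cochain p ≃ₗ[ℝ] Module.Dual ℝ (K.Cochain p) :=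
  (g.inner p).toDual (g.nondegenerate p)

/-- The adjoint coboundary operator `δ^⋆_{p+1} : C^{p+1} K → C^p K`. -/
def adjCobd (o : Orient K) (p : ℕ) : K.Cochain (p + 1) →ₗ[ℝ] K.Cochain p :=
  (g.riesz p).symm.toLinearMap ∘ₗ (o.cobd p).dualMap ∘ₗ (g.riesz (p + 1)).toLinearMap

theorem inner_adjCobd (o : Orient K) (p : ℕ) (σ : K.Cochain p) (τ : K.Cochain (p + 1)) :
    g.inner (p + 1) (o.cobd p σ) τ = g.inner p σ (g.adjCobd o p τ) := by
  have h : g.riesz p (g.adjCobd o p τ) σ = g.riesz (p + 1) τ (o.cobd p σ) := by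
    simp [adjCobd]
  rw [g.symm (p + 1), g.symm p]
  exact h.symm

/-- The Laplacian `Δ_p = δ^{p-1} δ^⋆_p + δ^⋆_{p+1} δ^p` (the first summand is absent if `p = 0`). -/
def laplacian (o : Orient K) : (p : ℕ) → K.Cochain p →ₗ[ℝ] K.Cochain p
  | 0 => g.adjCobd o 0 ∘ₗ o.cobd 0
  | p + 1 => o.cobd p ∘ₗ g.adjCobd o p + g.adjCobd o (p + 1) ∘ₗ o.cobd (p + 1)

/-- The harmonic cochains `Ker Δ_p`. -/
def harmonic (o : Orient K) (p : ℕ) : Submodule ℝ (K.Cochain p) := LinearMap.ker (g.laplacian o p)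

/-- The Hodge star `⋆_p : C^p K → C^q K`, `q = d - p`. -/
def star {o : Orient K} (S : CupProduct o) {q p d : ℕ} (h : q + p = d) :
    K.Cochain p →ₗ[ℝ] K.Cochain q :=
  (g.riesz q).symm.toLinearMap ∘ₗ (S.pairing h).flip

theorem inner_star {o : Orient K} (S : CupProduct o) {q p d : ℕ} (h : q + p = d)
    (σ : K.Cochain q) (τ : K.Cochain p) :
    g.inner q σ (g.star S h τ) =
      S.cup q p d h σ τ (K.fundamentalClass d) := by
  have h' : g.riesz q (g.star S h τ) σ = S.pairing h σ τ := by
    simp [star]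
  rw [g.symm q]
  exact h'

end CochainInner

end Geometry

end Polytopal

end

/-! Nondegeneracy being given, it remains to see that the pairing `(σ ⌣ τ)[K]` passes to cohomology,
and to count dimensions. By the Leibniz rule a product of a cocycle and a coboundary is, up to sign,
a coboundary, so it vanishes on `[K]` because `∂[K] = 0`: exactly two `d`-cells meet at each `(d -
1)`-cell, with opposite signs. Hence `H^p` and `H^{d-p}` have equal dimension
(`Subquotient.finrank_le_of_pairing`, used both ways), and rank-nullity gives `dim H^q = dim H_q`.
Harmonic cochains are the cocycles orthogonal to the coboundaries, so they represent cohomology. The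
projected star is the pairing read through the inner product, and nondegeneracy makes it injective.

These counts rest on `∂∂ = 0`, which is the geometric part (`Orient.sum_relOr_mul_relOr`), since
cells need not be convex. At relative interior points of a hyperface `b`, a cell `c` is locally a
half space `f ≤ 0`, with one functional `f` for all of `b` (`Mesh.exists_isBounding`). Around a
relative interior point of a `p`-face `a` of a `(p + 2)`-cell `c`, a small ellipse transverse to `a`
meets the boundary of `c` only in the hyperfaces `b` through `a`, once in each. The indicator of `c`
along this closed curve has total jump zero (`sum_jump_eq_zero`), and its jump at `b` is `ε(c, b)
ε(b, a)` times a sign common to all `b`. So the sum over `b` vanishes, however many `b` there are.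
-/

open scoped Topology

namespace Polytopal

/-! ### Relative interiors and their topology. -/

section Intrinsic

variable {V P : Type*} [NormedAddCommGroup V] [NormedSpace ℝ V]
  [MetricSpace P] [NormedAddTorsor V P]

theorem vadd_mem_affineSpan_iff {c : Set P} {x : P} (hx : x ∈ c) {v : V} :
    v +ᵥ x ∈ affineSpan ℝ c ↔ v ∈ vectorSpan ℝ c := by
  rw [← direction_affineSpan]
  exact AffineSubspace.vadd_mem_iff_mem_direction v (subset_affineSpan ℝ c hx)

theorem mem_vectorSpan_of_vadd_mem {c : Set P} {x : P} (hx : x ∈ c) {v : V} (hv : v +ᵥ x ∈ c) :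
    v ∈ vectorSpan ℝ c :=
  (vadd_mem_affineSpan_iff hx).1 (subset_affineSpan ℝ c hv)

/-- Trades the subspace topology of the affine hull for norms of vectors in `V`, the form in which
all local arguments below are made. -/
theorem mem_intrinsicInterior_iff_exists_pos {c : Set P} {x : P} :
    x ∈ intrinsicInterior ℝ c ↔
      x ∈ c ∧ ∃ r > 0, ∀ v ∈ vectorSpan ℝ c, ‖v‖ < r → v +ᵥ x ∈ c := by
  rw [mem_intrinsicInterior]
  constructor
  · rintro ⟨y, hy, rfl⟩
    refine ⟨interior_subset (s := Subtype.val ⁻¹' c) hy, ?_⟩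
    obtain ⟨r, hr, h⟩ := Metric.mem_nhds_iff.1 (mem_interior_iff_mem_nhds.1 hy)
    refine ⟨r, hr, fun v hv hvr => ?_⟩
    have hyc : (y : P) ∈ c := interior_subset (s := Subtype.val ⁻¹' c) hy
    have hm : v +ᵥ (y : P) ∈ affineSpan ℝ c := (vadd_mem_affineSpan_iff hyc).2 hv
    refine @h ⟨v +ᵥ (y : P), hm⟩ ?_
    rw [Metric.mem_ball, Subtype.dist_eq]
    simpa using hvr
  · rintro ⟨hx, r, hr, h⟩
    refine ⟨⟨x, subset_affineSpan ℝ c hx⟩, ?_, rfl⟩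
    rw [mem_interior_iff_mem_nhds, Metric.mem_nhds_iff]
    refine ⟨r, hr, fun z hz => ?_⟩
    have hz' : (z : P) = ((z : P) -ᵥ x) +ᵥ x := (vsub_vadd _ _).symm
    have hm : (z : P) -ᵥ x ∈ vectorSpan ℝ c := by
      rw [← vadd_mem_affineSpan_iff hx, ← hz']
      exact z.2
    have := h _ hm (by rwa [Metric.mem_ball, Subtype.dist_eq, dist_eq_norm_vsub V] at hz)
    rw [← hz'] at this
    exact this

theorem exists_pos_forall_vadd_mem_intrinsicInterior {c : Set P} {x : P}
    (hx : x ∈ intrinsicInterior ℝ c) :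
    ∃ r > 0, ∀ v ∈ vectorSpan ℝ c, ‖v‖ < r → v +ᵥ x ∈ intrinsicInterior ℝ c := by
  obtain ⟨_, r, hr, h⟩ := mem_intrinsicInterior_iff_exists_pos.1 hx
  refine ⟨r, hr, fun v hv hvr => mem_intrinsicInterior_iff_exists_pos.2
    ⟨h v hv hvr, r - ‖v‖, by linarith, fun w hw hwr => ?_⟩⟩
  rw [vadd_vadd]
  exact h _ (Submodule.add_mem _ hw hv) ((norm_add_le _ _).trans_lt (by linarith))

theorem mem_intrinsicFrontier_iff_of_isClosed {c : Set P} (hc : IsClosed c) {x : P} :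
    x ∈ intrinsicFrontier ℝ c ↔ x ∈ c ∧ x ∉ intrinsicInterior ℝ c := by
  rw [← intrinsicClosure_sdiff_intrinsicInterior,
    (hc.preimage continuous_subtype_val).intrinsicClosure]
  rfl

omit [NormedSpace ℝ V] in
theorem exists_pos_forall_vadd_notMem {c : Set P} (hc : IsClosed c) {x : P} (hx : x ∉ c) :
    ∃ r > 0, ∀ v : V, ‖v‖ < r → v +ᵥ x ∉ c := by
  obtain ⟨r, hr, h⟩ := Metric.mem_nhds_iff.1 (hc.isOpen_compl.mem_nhds hx)
  exact ⟨r, hr, fun v hv => h (by rwa [Metric.mem_ball, dist_vadd_left])⟩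

/-- The indicator with values in `Bool` is continuous, hence constant. It serves to spread "inside"
or "outside" over one side of a hyperplane, and to spread the outward side along a hyperface. -/
theorem _root_.IsPreconnected.iff_of_eventually_iff {X : Type*} [TopologicalSpace X] {s : Set X}
    (hs : IsPreconnected s) {f : X → Prop} (h : ∀ x ∈ s, ∀ᶠ y in 𝓝[s] x, (f y ↔ f x))
    {x y : X} (hx : x ∈ s) (hy : y ∈ s) : f x ↔ f y := by
  classical
  have hf : ContinuousOn (fun x => decide (f x)) s := fun z hz =>
    (tendsto_const_nhds (x := decide (f z))).congr' <| by
      filter_upwards [h z hz] with w hw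
      simp [hw]
  simpa using hs.constant hf hx hy

/-! ### Flat balls -/

namespace IsFlatBall

variable {X : Set P}

theorem isClosed (hX : IsFlatBall X) : IsClosed X := by
  obtain ⟨e, -⟩ := hX
  have : CompactSpace X := e.symm.compactSpace
  exact (isCompact_iff_compactSpace.2 this).isClosed

/-- A closed set is the disjoint union of its relative frontier and interior, so a chart matching
frontier and sphere also matches interior and open ball. -/
theorem mem_intrinsicInterior_iff_norm (hX : IsClosed X)
    {h : X ≃ₜ Metric.closedBall (0 : EuclideanSpace ℝ (Fin (dim X))) 1}
    (hh : ∀ x : X, (x : P) ∈ intrinsicFrontier ℝ X ↔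
      ‖(h x : EuclideanSpace ℝ (Fin (dim X)))‖ = 1) (x : X) :
    (x : P) ∈ intrinsicInterior ℝ X ↔
      (h x : EuclideanSpace ℝ (Fin (dim X))) ∈ Metric.ball 0 1 := by
  have h1 := hh x
  rw [mem_intrinsicFrontier_iff_of_isClosed hX] at h1
  have h2 : ‖(h x : EuclideanSpace ℝ (Fin (dim X)))‖ ≤ 1 := mem_closedBall_zero_iff.1 (h x).2
  rw [mem_ball_zero_iff, lt_iff_le_and_ne]
  have h3 := x.2
  tauto

theorem image_ball (hX : IsClosed X)
    {h : X ≃ₜ Metric.closedBall (0 : EuclideanSpace ℝ (Fin (dim X))) 1}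
    (hh : ∀ x : X, (x : P) ∈ intrinsicFrontier ℝ X ↔
      ‖(h x : EuclideanSpace ℝ (Fin (dim X)))‖ = 1) :
    intrinsicInterior ℝ X =
      (fun y => (h.symm y : P)) '' (Subtype.val ⁻¹' Metric.ball 0 1) := by
  ext x
  constructor
  · intro hx
    have hx' : x ∈ X := intrinsicInterior_subset hx
    exact ⟨h ⟨x, hx'⟩, (mem_intrinsicInterior_iff_norm hX hh ⟨x, hx'⟩).1 hx, by simp⟩
  · rintro ⟨y, hy, rfl⟩
    rw [mem_intrinsicInterior_iff_norm hX hh]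
    simpa using hy

theorem nonempty_intrinsicInterior (hX : IsFlatBall X) : (intrinsicInterior ℝ X).Nonempty := by
  obtain ⟨h, hh⟩ := id hX
  rw [image_ball hX.isClosed hh]
  exact Set.Nonempty.image _ ⟨⟨0, by simp⟩, by simp⟩

theorem isPreconnected_intrinsicInterior (hX : IsFlatBall X) :
    IsPreconnected (intrinsicInterior ℝ X) := by
  obtain ⟨h, hh⟩ := id hX
  rw [image_ball hX.isClosed hh]
  refine IsPreconnected.image ?_ _ (by fun_prop)
  rw [← Topology.IsInducing.subtypeVal.isPreconnected_image, Subtype.image_preimage_coe,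
    Set.inter_eq_right.2 Metric.ball_subset_closedBall]
  exact (convex_ball _ _).isPreconnected

theorem subset_closure_intrinsicInterior (hX : IsFlatBall X) :
    X ⊆ closure (intrinsicInterior ℝ X) := by
  obtain ⟨h, hh⟩ := id hX
  rw [image_ball hX.isClosed hh]
  intro x hx
  have hcont : Continuous (fun y => (h.symm y : P)) := by fun_prop
  refine image_closure_subset_closure_image hcont ⟨h ⟨x, hx⟩, ?_, by simp⟩
  rw [Topology.IsInducing.subtypeVal.closure_eq_preimage_closure_image,
    Subtype.image_preimage_coe, Set.inter_eq_right.2 Metric.ball_subset_closedBall,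
    closure_ball _ one_ne_zero]
  exact (h ⟨x, hx⟩).2

end IsFlatBall

end Intrinsic

/-! ### Faces -/

section Faces

variable {V P : Type*} [NormedAddCommGroup V] [NormedSpace ℝ V]
  [MetricSpace P] [NormedAddTorsor V P]

theorem IsFace.eq_or_dim_lt {S : Set (Set P)} {a b : Set P} (h : IsFace S a b) :
    a = b ∨ dim a < dim b := by
  induction h with
  | refl => exact Or.inl rfl
  | tail _ h ih =>
    right
    have := h.2.2.1
    rcases ih with rfl | ih <;> omega

theorem IsFace.eq_of_dim_eq {S : Set (Set P)} {a b : Set P} (h : IsFace S a b)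
    (hd : dim a = dim b) : a = b :=
  h.eq_or_dim_lt.resolve_right hd.not_lt

theorem IsFace.isHyperface {S : Set (Set P)} {a b : Set P} (h : IsFace S a b)
    (hd : dim a + 1 = dim b) : IsHyperface S a b := by
  rcases Relation.ReflTransGen.cases_tail h with rfl | ⟨y, hay, hyb⟩
  · omega
  · have := hyb.2.2.1
    rwa [IsFace.eq_of_dim_eq hay (by omega)]

namespace Mesh

variable (K : Mesh P) {X Y Z : Set P}

theorem isClosed (hX : X ∈ K.cells) : IsClosed X := (K.isFlatBall X hX).isClosed

theorem mem_intrinsicFrontier_iff (hX : X ∈ K.cells) {x : P} :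
    x ∈ intrinsicFrontier ℝ X ↔ x ∈ X ∧ x ∉ intrinsicInterior ℝ X :=
  mem_intrinsicFrontier_iff_of_isClosed (K.isClosed hX)

variable {K}

theorem subset_of_isHyperface (h : IsHyperface K.cells Y X) : Y ⊆ X :=
  h.2.2.2.trans (intrinsicFrontier_subset (K.isClosed h.2.1))

theorem subset_of_isFace (h : IsFace K.cells Y X) : Y ⊆ X := by
  induction h with
  | refl => exact subset_rfl
  | tail _ h ih => exact ih.trans (subset_of_isHyperface h)

/-- A proper face lies in a hyperface, hence in the relative frontier. -/
theorem eq_of_isFace_of_mem_intrinsicInterior (h : IsFace K.cells Y X) {x : P} (hx : x ∈ Y)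
    (hxX : x ∈ intrinsicInterior ℝ X) : Y = X := by
  rcases Relation.ReflTransGen.cases_tail h with h | ⟨Z, hYZ, hZX⟩
  · exact h.symm
  · exact absurd hxX
      ((K.mem_intrinsicFrontier_iff hZX.2.1).1 (hZX.2.2.2 (subset_of_isFace hYZ hx))).2

/-- The point lies in some common face of `Y` and `X`; since it is relative interior in `Y`, that
face is `Y` itself. -/
theorem isFace_of_mem_intrinsicInterior (hX : X ∈ K.cells) (hY : Y ∈ K.cells) {x : P}
    (hx : x ∈ intrinsicInterior ℝ Y) (hxX : x ∈ X) : IsFace K.cells Y X := by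
  have h : x ∈ Y ∩ X := ⟨intrinsicInterior_subset hx, hxX⟩
  rw [K.inter_eq Y hY X hX] at h
  obtain ⟨Z, ⟨hZY, hZX⟩, hxZ⟩ := h
  rwa [← eq_of_isFace_of_mem_intrinsicInterior hZY hxZ hx]

/-- Near a point of a cell `c`, all boundary points of `c` lie on hyperfaces through that point. -/
theorem exists_pos_frontier_iff (hX : X ∈ K.cells) (x : P) :
    ∃ r > 0, ∀ v : V, ‖v‖ < r →
      (v +ᵥ x ∈ intrinsicFrontier ℝ X ↔ ∃ Y, IsHyperface K.cells Y X ∧ x ∈ Y ∧ v +ᵥ x ∈ Y) := by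
  -- The hyperfaces missing `x` form a finite family of closed sets, so a whole ball around `x`
  -- avoids them.
  have hfin : {Y | IsHyperface K.cells Y X ∧ x ∉ Y}.Finite :=
    K.finite_cells.subset fun Y hY => hY.1.1
  obtain ⟨r, hr, h⟩ := exists_pos_forall_vadd_notMem (V := V)
    (Set.Finite.isClosed_biUnion hfin (f := id) fun Y hY => K.isClosed hY.1.1)
    (x := x) (by
      simp only [Set.mem_iUnion, not_exists]
      exact fun Y hY h => hY.2 h)
  refine ⟨r, hr, fun v hv => ?_⟩
  rw [K.boundary_eq X hX]
  constructor
  · rintro ⟨Y, hY, hvY⟩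
    refine ⟨Y, hY, ?_, hvY⟩
    by_contra hxY
    exact h v hv (Set.mem_biUnion (show Y ∈ {Y | IsHyperface K.cells Y X ∧ x ∉ Y} from ⟨hY, hxY⟩)
      hvY)
  · rintro ⟨Y, hY, -, hvY⟩
    exact ⟨Y, hY, hvY⟩

end Mesh

end Faces

end Polytopal

namespace Polytopal

/-! ### A cell is locally a half space along a hyperface. -/

section HalfSpace

variable {V P : Type*} [NormedAddCommGroup V] [NormedSpace ℝ V]
  [MetricSpace P] [NormedAddTorsor V P]

/-- Near `x`, the set `c` is the closed half space `f ≤ 0` of its affine hull (with `x` as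
origin). -/
def IsHalfSpaceNear (c : Set P) (f : V →ₗ[ℝ] ℝ) (x : P) : Prop :=
  ∃ r > 0, ∀ v ∈ vectorSpan ℝ c, ‖v‖ < r →
    (v +ᵥ x ∈ c ↔ f v ≤ 0) ∧ (v +ᵥ x ∈ intrinsicInterior ℝ c ↔ f v < 0)

/-- The functional `f` cuts out the direction of `b` from that of `c`, and at all relative interior
points of `b` the set `c` is locally the half space `f ≤ 0`. -/
structure IsBounding (c b : Set P) (f : V →ₗ[ℝ] ℝ) : Prop where
  eq_zero_iff : ∀ v ∈ vectorSpan ℝ c, (f v = 0 ↔ v ∈ vectorSpan ℝ b)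
  isHalfSpaceNear : ∀ x ∈ intrinsicInterior ℝ b, IsHalfSpaceNear c f x

theorem IsHalfSpaceNear.vadd {c : Set P} {f : V →ₗ[ℝ] ℝ} {x : P} (h : IsHalfSpaceNear c f x) :
    ∃ r > 0, ∀ w ∈ vectorSpan ℝ c, f w = 0 → ‖w‖ < r → IsHalfSpaceNear c f (w +ᵥ x) := by
  obtain ⟨r, hr, h⟩ := h
  refine ⟨r, hr, fun w hw hfw hwr => ⟨r - ‖w‖, by linarith, fun v hv hvr => ?_⟩⟩
  have := h (v + w) (Submodule.add_mem _ hv hw) ((norm_add_le _ _).trans_lt (by linarith))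
  rwa [map_add, hfw, add_zero, ← vadd_vadd] at this

theorem exists_pos_smul_norm_lt (v : V) {r : ℝ} (hr : 0 < r) : ∃ t : ℝ, 0 < t ∧ ‖t • v‖ < r := by
  refine ⟨r / (‖v‖ + 1), by positivity, ?_⟩
  rw [norm_smul, Real.norm_of_nonneg (by positivity), div_mul_eq_mul_div, div_lt_iff₀ (by positivity)]
  nlinarith [norm_nonneg v]

theorem IsHalfSpaceNear.not_neg {c : Set P} {f : V →ₗ[ℝ] ℝ} {x : P} {v : V}
    (hv : v ∈ vectorSpan ℝ c) (hfv : f v ≠ 0) (h : IsHalfSpaceNear c f x) :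
    ¬ IsHalfSpaceNear c (-f) x := by
  rintro ⟨r', hr', h'⟩
  obtain ⟨r, hr, h⟩ := h
  obtain ⟨t, ht, htv⟩ := exists_pos_smul_norm_lt v (lt_min hr hr')
  have h1 := (h _ (Submodule.smul_mem _ t hv) (htv.trans_le (min_le_left _ _))).1
  have h2 := (h' _ (Submodule.smul_mem _ t hv) (htv.trans_le (min_le_right _ _))).1
  rw [h1] at h2
  simp only [map_smul, smul_eq_mul, LinearMap.neg_apply] at h2
  have : t * f v ≠ 0 := mul_ne_zero ht.ne' hfv
  rcases lt_or_gt_of_ne this with h3 | h3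
  · have := h2.1 h3.le
    linarith
  · have := h2.2 (by linarith)
    linarith

namespace Mesh

variable {K : Mesh P} {c b : Set P}

theorem exists_notMem_vectorSpan [FiniteDimensional ℝ V] (h : IsHyperface K.cells b c) :
    ∃ v ∈ vectorSpan ℝ c, v ∉ vectorSpan ℝ b := by
  by_contra! hc
  have h1 : dim c ≤ dim b := Submodule.finrank_mono hc
  have := h.2.2.1
  omega

/-- A functional killing the direction of `b` but not some `v₀` in that of `c` has a proper kernel
in the latter; as `b` has codimension one, this kernel is exactly the direction of `b`. -/
theorem exists_functional [FiniteDimensional ℝ V] (h : IsHyperface K.cells b c) :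
    ∃ f : V →ₗ[ℝ] ℝ, ∀ v ∈ vectorSpan ℝ c, (f v = 0 ↔ v ∈ vectorSpan ℝ b) := by
  obtain ⟨v₀, hv₀, hv₀b⟩ := exists_notMem_vectorSpan h
  obtain ⟨f, hf, hfb⟩ := Submodule.exists_le_ker_of_notMem hv₀b
  refine ⟨f, fun v hv => ⟨fun hfv => ?_, fun hvb => hfb hvb⟩⟩
  have hle : vectorSpan ℝ b ≤ vectorSpan ℝ c ⊓ LinearMap.ker f :=
    le_inf (vectorSpan_mono ℝ (subset_of_isHyperface h)) hfb
  have hlt : vectorSpan ℝ c ⊓ LinearMap.ker f < vectorSpan ℝ c :=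
    lt_of_le_of_ne inf_le_left fun he => hf (he.ge hv₀).2
  have h1 := Submodule.finrank_lt_finrank_of_lt hlt
  have h2 : dim b + 1 = dim c := h.2.2.1
  rw [Submodule.eq_of_le_of_finrank_le hle (by unfold dim at h2; omega)]
  exact ⟨hv, hfv⟩

/-- Near a relative interior point of a hyperface `b` of `c`, the boundary of `c` is `b`, which is
open in its affine hull. -/
theorem exists_pos_frontier_iff_mem_vectorSpan (h : IsHyperface K.cells b c) {x : P}
    (hx : x ∈ intrinsicInterior ℝ b) :
    ∃ r > 0, ∀ v : V, ‖v‖ < r →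
      (v +ᵥ x ∈ intrinsicFrontier ℝ c ↔ v ∈ vectorSpan ℝ b) := by
  obtain ⟨r, hr, h₁⟩ := exists_pos_frontier_iff h.2.1 (V := V) x
  obtain ⟨hxb, r', hr', h₂⟩ := mem_intrinsicInterior_iff_exists_pos.1 hx
  refine ⟨min r r', lt_min hr hr', fun v hv => ?_⟩
  rw [h₁ v (hv.trans_le (min_le_left _ _))]
  constructor
  · rintro ⟨Y, hY, hxY, hvY⟩
    -- Any hyperface through `x` has `b` as a face, and by dimension it equals `b`.
    have hbY := (isFace_of_mem_intrinsicInterior hY.1 h.1 hx hxY).eq_of_dim_eq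
      (by have := h.2.2.1; have := hY.2.2.1; omega)
    subst hbY
    exact mem_vectorSpan_of_vadd_mem hxb hvY
  · intro hvb
    exact ⟨b, h, hxb, h₂ v hvb (hv.trans_le (min_le_right _ _))⟩

/-- Off the frontier, the affine hull splits into two open sets: the relative interior and the
complement of `c`. -/
theorem eventually_mem_intrinsicInterior_iff (hc : c ∈ K.cells) {x : P} {v : V}
    (hv : v ∈ vectorSpan ℝ c) (hvx : v +ᵥ x ∉ intrinsicFrontier ℝ c) {s : Set V}
    (hs : s ⊆ vectorSpan ℝ c) :
    ∀ᶠ w in 𝓝[s] v, (w +ᵥ x ∈ intrinsicInterior ℝ c ↔ v +ᵥ x ∈ intrinsicInterior ℝ c) := by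
  by_cases hin : v +ᵥ x ∈ intrinsicInterior ℝ c
  · obtain ⟨r, hr, h⟩ := exists_pos_forall_vadd_mem_intrinsicInterior hin
    filter_upwards [self_mem_nhdsWithin, mem_nhdsWithin_of_mem_nhds (Metric.ball_mem_nhds v hr)]
      with w hws hwr
    have := h (w - v) (Submodule.sub_mem _ (hs hws) hv) (by rwa [mem_ball_iff_norm] at hwr)
    rw [vadd_vadd, sub_add_cancel] at this
    simp [this, hin]
  · have hnc : v +ᵥ x ∉ c := fun hvc => hvx ((K.mem_intrinsicFrontier_iff hc).2 ⟨hvc, hin⟩)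
    have hcont : Continuous fun w : V => w +ᵥ x := by fun_prop
    filter_upwards [mem_nhdsWithin_of_mem_nhds
      (((K.isClosed hc).preimage hcont).isOpen_compl.mem_nhds hnc)] with w hw
    have : w +ᵥ x ∉ intrinsicInterior ℝ c := fun h => hw (intrinsicInterior_subset (s := c) h)
    simp [this, hin]

/-- In a small ball the frontier is the hyperplane `f = 0`, and each open half ball, being convex,
is entirely inside or entirely outside. One side is inside because `x` is in the closure of the
interior; both cannot be, or `x` would be an interior point. -/
theorem isHalfSpaceNear_or [FiniteDimensional ℝ V] (h : IsHyperface K.cells b c)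
    {f : V →ₗ[ℝ] ℝ} (hf : ∀ v ∈ vectorSpan ℝ c, (f v = 0 ↔ v ∈ vectorSpan ℝ b)) {x : P}
    (hx : x ∈ intrinsicInterior ℝ b) : IsHalfSpaceNear c f x ∨ IsHalfSpaceNear c (-f) x := by
  obtain ⟨r, hr, hfr⟩ := exists_pos_frontier_iff_mem_vectorSpan h hx
  have hxF : x ∈ intrinsicFrontier ℝ c := by
    simpa using (hfr 0 (by simpa using hr)).2 (Submodule.zero_mem _)
  have hxc := ((K.mem_intrinsicFrontier_iff h.2.1).1 hxF).1
  have hxi := ((K.mem_intrinsicFrontier_iff h.2.1).1 hxF).2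
  have key : ∀ g : V →ₗ[ℝ] ℝ, (∀ v ∈ vectorSpan ℝ c, (g v = 0 ↔ v ∈ vectorSpan ℝ b)) →
      ∀ v ∈ vectorSpan ℝ c, ∀ w ∈ vectorSpan ℝ c, ‖v‖ < r → ‖w‖ < r → 0 < g v → 0 < g w →
      (v +ᵥ x ∈ intrinsicInterior ℝ c ↔ w +ᵥ x ∈ intrinsicInterior ℝ c) := by
    intro g hg v hv w hw hvr hwr hgv hgw
    have hconv : Convex ℝ ((vectorSpan ℝ c : Set V) ∩ Metric.ball 0 r ∩ {v | 0 < g v}) :=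
      ((vectorSpan ℝ c).convex.inter (convex_ball _ _)).inter
        (convex_halfSpace_gt g.isLinear 0)
    refine hconv.isPreconnected.iff_of_eventually_iff
      (f := fun v => v +ᵥ x ∈ intrinsicInterior ℝ c) ?_ ⟨⟨hv, by simpa using hvr⟩, hgv⟩
        ⟨⟨hw, by simpa using hwr⟩, hgw⟩
    rintro u ⟨⟨huc, hur⟩, hgu⟩
    refine eventually_mem_intrinsicInterior_iff h.2.1 huc ?_ (fun z hz => hz.1.1)
    rw [hfr u (by simpa using hur), ← hg u huc]
    exact hgu.ne'
  have hf' : ∀ v ∈ vectorSpan ℝ c, ((-f) v = 0 ↔ v ∈ vectorSpan ℝ b) := fun v hv => by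
    rw [LinearMap.neg_apply, neg_eq_zero, hf v hv]
  -- the conclusion from one point on each side
  have concl : ∀ g : V →ₗ[ℝ] ℝ, (∀ v ∈ vectorSpan ℝ c, (g v = 0 ↔ v ∈ vectorSpan ℝ b)) →
      (∀ v ∈ vectorSpan ℝ c, ‖v‖ < r → g v < 0 → v +ᵥ x ∈ intrinsicInterior ℝ c) →
      (∀ v ∈ vectorSpan ℝ c, ‖v‖ < r → 0 < g v → v +ᵥ x ∉ intrinsicInterior ℝ c) →
      IsHalfSpaceNear c g x := by
    intro g hg hneg hpos
    refine ⟨r, hr, fun v hv hvr => ?_⟩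
    have hF := hfr v hvr
    rw [K.mem_intrinsicFrontier_iff h.2.1, ← hg v hv] at hF
    rcases lt_trichotomy (g v) 0 with h0 | h0 | h0
    · have := hneg v hv hvr h0
      simp [this, h0, h0.le, intrinsicInterior_subset this]
    · have := hF.2 h0
      simp [this, h0]
    · have h1 := hpos v hv hvr h0
      have h2 : v +ᵥ x ∉ c := fun h2 => h0.ne' (hF.1 ⟨h2, h1⟩)
      simp [h1, h2, h0.not_gt, h0]
  obtain ⟨y, hy, hyr⟩ := Metric.mem_closure_iff.1
    ((K.isFlatBall c h.2.1).subset_closure_intrinsicInterior hxc) r hr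
  obtain ⟨u, rfl⟩ : ∃ u : V, u +ᵥ x = y := ⟨y -ᵥ x, vsub_vadd _ _⟩
  rw [dist_comm, dist_vadd_left] at hyr
  have huc := mem_vectorSpan_of_vadd_mem hxc (intrinsicInterior_subset hy)
  have main : ∀ g : V →ₗ[ℝ] ℝ, (∀ v ∈ vectorSpan ℝ c, (g v = 0 ↔ v ∈ vectorSpan ℝ b)) →
      g u < 0 → IsHalfSpaceNear c g x := by
    intro g hg hgu
    have hg' : ∀ v ∈ vectorSpan ℝ c, ((-g) v = 0 ↔ v ∈ vectorSpan ℝ b) := fun v hv => by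
      rw [LinearMap.neg_apply, neg_eq_zero, hg v hv]
    have hneg : ∀ v ∈ vectorSpan ℝ c, ‖v‖ < r → g v < 0 → v +ᵥ x ∈ intrinsicInterior ℝ c :=
      fun v hv hvr hgv => (key (-g) hg' v hv u huc hvr hyr (by simpa using hgv)
        (by simpa using hgu)).2 hy
    refine concl g hg hneg fun v hv hvr hgv hvi => hxi ?_
    refine mem_intrinsicInterior_iff_exists_pos.2 ⟨hxc, r, hr, fun w hw hwr => ?_⟩
    rcases lt_trichotomy (g w) 0 with h0 | h0 | h0
    · exact intrinsicInterior_subset (hneg w hw hwr h0)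
    · exact ((K.mem_intrinsicFrontier_iff h.2.1).1 ((hfr w hwr).2 ((hg w hw).1 h0))).1
    · exact intrinsicInterior_subset ((key g hg v hv w hw hvr hwr hgv h0).1 hvi)
  have hfu : f u ≠ 0 := fun h0 => ((K.mem_intrinsicFrontier_iff h.2.1).1
    ((hfr u hyr).2 ((hf u huc).1 h0))).2 hy
  rcases lt_or_gt_of_ne hfu with h0 | h0
  · exact Or.inl (main f hf h0)
  · exact Or.inr (main (-f) hf' (by simpa using h0))

/-- Which of `f` and `-f` is right is locally constant along the relative interior of `b`, which is
connected. -/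
theorem exists_isBounding [FiniteDimensional ℝ V] (h : IsHyperface K.cells b c) :
    ∃ f : V →ₗ[ℝ] ℝ, IsBounding c b f := by
  obtain ⟨f, hf⟩ := exists_functional h
  obtain ⟨v, hv, hvb⟩ := exists_notMem_vectorSpan h
  have hfv : f v ≠ 0 := fun h0 => hvb ((hf v hv).1 h0)
  have hf' : ∀ v ∈ vectorSpan ℝ c, ((-f) v = 0 ↔ v ∈ vectorSpan ℝ b) := fun v hv => by
    rw [LinearMap.neg_apply, neg_eq_zero, hf v hv]
  have hle : vectorSpan ℝ b ≤ vectorSpan ℝ c := vectorSpan_mono ℝ (subset_of_isHyperface h)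
  have hloc : ∀ g : V →ₗ[ℝ] ℝ, (∀ v ∈ vectorSpan ℝ c, (g v = 0 ↔ v ∈ vectorSpan ℝ b)) →
      ∀ x ∈ intrinsicInterior ℝ b, IsHalfSpaceNear c g x →
      ∀ᶠ y in 𝓝[intrinsicInterior ℝ b] x, IsHalfSpaceNear c g y := by
    intro g hg x hx hgx
    obtain ⟨r, hr, hr'⟩ := hgx.vadd
    filter_upwards [self_mem_nhdsWithin, mem_nhdsWithin_of_mem_nhds (Metric.ball_mem_nhds x hr)]
      with y hyb hyr
    have hyx : y -ᵥ x ∈ vectorSpan ℝ b := vsub_mem_vectorSpan ℝ (intrinsicInterior_subset hyb)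
      (intrinsicInterior_subset hx)
    have := hr' (y -ᵥ x) (hle hyx) ((hg _ (hle hyx)).2 hyx)
      (by rwa [Metric.mem_ball, dist_eq_norm_vsub V] at hyr)
    rwa [vsub_vadd] at this
  obtain ⟨x₀, hx₀⟩ := (K.isFlatBall b h.1).nonempty_intrinsicInterior
  have hconst : ∀ x ∈ intrinsicInterior ℝ b, (IsHalfSpaceNear c f x ↔ IsHalfSpaceNear c f x₀) := by
    intro x hx
    refine (K.isFlatBall b h.1).isPreconnected_intrinsicInterior.iff_of_eventually_iff
      (f := IsHalfSpaceNear c f) (fun y hy => ?_) hx hx₀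
    rcases isHalfSpaceNear_or h hf hy with hy' | hy'
    · filter_upwards [hloc f hf y hy hy'] with z hz
      simp [hz, hy']
    · filter_upwards [hloc (-f) hf' y hy hy'] with z hz
      have h1 : ¬ IsHalfSpaceNear c f z := fun h1 => h1.not_neg hv hfv hz
      have h2 : ¬ IsHalfSpaceNear c f y := fun h1 => h1.not_neg hv hfv hy'
      simp [h1, h2]
  by_cases h0 : IsHalfSpaceNear c f x₀
  · exact ⟨f, hf, fun x hx => (hconst x hx).2 h0⟩
  · exact ⟨-f, hf', fun x hx => (isHalfSpaceNear_or h hf hx).resolve_left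
      fun h1 => h0 ((hconst x hx).1 h1)⟩

end Mesh

/-- Outward vectors form an open half space, so the choice of one will not matter. Nonemptiness of
the relative interior keeps the outward condition from being vacuous. -/
theorem IsBounding.isOutward_iff {c b : Set P} {f : V →ₗ[ℝ] ℝ} (hf : IsBounding c b f)
    (hb : (intrinsicInterior ℝ b).Nonempty) (n : vectorSpan ℝ c) :
    IsOutward c b n ↔ 0 < f n := by
  have hsmall : ∀ r > 0, ∀ᶠ t in 𝓝[>] (0 : ℝ), ‖t • (n : V)‖ < r := by
    intro r hr
    have hc : Continuous fun t : ℝ => ‖t • (n : V)‖ := by fun_prop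
    exact mem_nhdsWithin_of_mem_nhds (hc.tendsto 0 (Iio_mem_nhds (by simpa using hr)))
  constructor
  · rintro ⟨hnb, hn⟩
    obtain ⟨x, hx⟩ := hb
    obtain ⟨r, hr, h⟩ := hf.isHalfSpaceNear x hx
    obtain ⟨t, ⟨⟨ht1, ht2⟩, ht3⟩, ht⟩ := ((hn x hx).and (hsmall r hr)).and self_mem_nhdsWithin |>.exists
    rw [(h _ (Submodule.smul_mem _ t n.2) ht3).1] at ht1
    rw [map_smul, smul_eq_mul, not_le] at ht1
    exact pos_of_mul_pos_right ht1 (le_of_lt ht)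
  · intro hn
    refine ⟨fun hb => hn.ne' ((hf.eq_zero_iff _ n.2).2 hb), fun x hx => ?_⟩
    obtain ⟨r, hr, h⟩ := hf.isHalfSpaceNear x hx
    filter_upwards [hsmall r hr, self_mem_nhdsWithin] with t htr ht
    have ht' : 0 < t * f n := mul_pos ht hn
    rw [(h _ (Submodule.smul_mem _ t n.2) htr).1,
      (h _ (Submodule.neg_mem _ (Submodule.smul_mem _ t n.2)) (by rwa [norm_neg])).2,
      map_neg, map_smul, smul_eq_mul]
    constructor <;> linarith

end HalfSpace

end Polytopal

namespace Polytopal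

/-! ### Relative orientations as contraction identities. -/

section RelOr

variable {V P : Type*} [NormedAddCommGroup V] [NormedSpace ℝ V] [FiniteDimensional ℝ V]
  [MetricSpace P] [NormedAddTorsor V P] {K : Mesh P} (o : Orient K)

omit [FiniteDimensional ℝ V] in
theorem Orient.relOr_of_not_hyperface {p : ℕ} {c : K.Cell (p + 1)} {b : K.Cell p}
    (h : ¬ b.Hyperface c) : o.relOr c b = 0 := dif_neg h

omit [FiniteDimensional ℝ V] in
theorem Orient.relOr_eq_one_or {p : ℕ} {c : K.Cell (p + 1)} {b : K.Cell p}
    (h : b.Hyperface c) : o.relOr c b = 1 ∨ o.relOr c b = -1 := by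
  unfold Orient.relOr
  rw [dif_pos h]
  split_ifs
  · exact Or.inl rfl
  · exact Or.inr rfl

/-- Too many vectors for the dimension of `U`. Consequently the contraction by `n`, restricted to
`b`, ignores the component of `n` along `b`. -/
theorem _root_.AlternatingMap.map_vecCons_eq_zero {W : Type*} [AddCommGroup W] [Module ℝ W]
    {U : Submodule ℝ W} [FiniteDimensional ℝ U] {p : ℕ} (hU : Module.finrank ℝ U = p)
    (ω : W [⋀^Fin (p + 1)]→ₗ[ℝ] ℝ) {v : W} (hv : v ∈ U) (m : Fin p → U) :
    ω (Matrix.vecCons v (fun i => (m i : W))) = 0 := by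
  refine ω.map_linearDependent _ fun hli => ?_
  have : (Matrix.vecCons v (fun i => (m i : W))) =
      U.subtype ∘ (Matrix.vecCons ⟨v, hv⟩ m : Fin (p + 1) → U) := by
    funext i
    refine Fin.cases ?_ (fun j => ?_) i <;> simp
  rw [this] at hli
  have := hli.of_comp.fintype_card_le_finrank
  simp [hU] at this

/-- A basis of `U` together with `n` is a basis of `W`. -/
theorem _root_.AlternatingMap.curryLeft_compLinearMap_ne_zero {W : Type*} [AddCommGroup W]
    [Module ℝ W] [FiniteDimensional ℝ W] {U : Submodule ℝ W} {p : ℕ}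
    (hU : Module.finrank ℝ U = p) (hW : Module.finrank ℝ W = p + 1)
    {ω : W [⋀^Fin (p + 1)]→ₗ[ℝ] ℝ} (hω : ω ≠ 0) {n : W} (hn : n ∉ U) :
    (ω.curryLeft n).compLinearMap U.subtype ≠ 0 := by
  let e := Module.finBasisOfFinrankEq ℝ U hU
  have hli : LinearIndependent ℝ (Matrix.vecCons n (fun i => (e i : W))) := by
    refine LinearIndependent.finCons (e.linearIndependent.map' U.subtype U.ker_subtype) ?_
    rw [show (fun i => (e i : W)) = U.subtype ∘ e from rfl, Set.range_comp, Submodule.span_image, e.span_eq, Submodule.map_subtype_top]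
    exact hn
  have := (AlternatingMap.map_basis_ne_zero_iff
    (basisOfLinearIndependentOfCardEqFinrank hli (by simp [hW])) ω).2 hω
  intro h0
  apply this
  rw [coe_basisOfLinearIndependentOfCardEqFinrank]
  have := congrArg (fun ζ => ζ e) h0
  exact this

/-- Frees `relOr` from the choices in its definition: two forms for `or(c)` differ by a positive
factor, and two outward vectors by a positive factor and a vector along `b`. -/
theorem Orient.exists_pos_contraction_eq {p : ℕ} {c : K.Cell (p + 1)} {b : K.Cell p}
    (h : b.Hyperface c) {f : V →ₗ[ℝ] ℝ} (hf : IsBounding c.carrier b.carrier f)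
    (n : vectorSpan ℝ c.carrier) (hn : 0 < f n)
    {ω : vectorSpan ℝ c.carrier [⋀^Fin (p + 1)]→ₗ[ℝ] ℝ} (hω : ω ≠ 0)
    (hωc : rayOfNeZero ℝ ω hω = o.or c)
    {η : vectorSpan ℝ b.carrier [⋀^Fin p]→ₗ[ℝ] ℝ} (hη : η ≠ 0)
    (hηb : rayOfNeZero ℝ η hη = o.or b) :
    ∃ k : ℝ, 0 < k ∧ ∀ m : Fin p → vectorSpan ℝ b.carrier,
      ω (Matrix.vecCons n (fun i => Submodule.inclusion (vectorSpan_mono ℝ h.subset) (m i))) =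
        k * o.relOr c b * η m := by
  have hle := vectorSpan_mono ℝ h.subset
  have hbI := (K.isFlatBall b.carrier h.1).nonempty_intrinsicInterior
  have hdb : Module.finrank ℝ (vectorSpan ℝ b.carrier) = p := b.2.2
  have hdc : Module.finrank ℝ (vectorSpan ℝ c.carrier) = p + 1 := c.2.2
  by_cases hex : ∃ (n : vectorSpan ℝ c.carrier)
        (ω : vectorSpan ℝ c.carrier [⋀^Fin (p + 1)]→ₗ[ℝ] ℝ) (hω : ω ≠ 0)
        (hη : (ω.curryLeft n).compLinearMap
          (Submodule.inclusion (vectorSpan_mono ℝ h.subset)) ≠ 0),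
        IsOutward c.carrier b.carrier n ∧ rayOfNeZero ℝ ω hω = o.or c ∧
          rayOfNeZero ℝ _ hη = o.or b
  · have hε : o.relOr c b = 1 := by
      unfold Orient.relOr
      rw [dif_pos h, if_pos hex]
    obtain ⟨n', ω', hω', hη', hout, hω'c, hη'b⟩ := hex
    rw [hf.isOutward_iff hbI] at hout
    obtain ⟨k₁, hk₁, hk₁'⟩ := ((ray_eq_iff hω' hω).1 (hω'c.trans hωc.symm)).exists_pos_left hω' hω
    obtain ⟨k₂, hk₂, hk₂'⟩ := ((ray_eq_iff hη hη').1 (hηb.trans hη'b.symm)).exists_pos_left hη hη'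
    -- `n = s • n' + u` with `s > 0` and `u` in the direction of `b`
    let s := f n / f n'
    have hs : 0 < s := div_pos hn hout
    have hu : (n : V) - s • (n' : V) ∈ vectorSpan ℝ b.carrier := by
      rw [← hf.eq_zero_iff _ (Submodule.sub_mem _ n.2 (Submodule.smul_mem _ s n'.2))]
      simp only [map_sub, map_smul, smul_eq_mul, s]
      field_simp
      ring
    have hle' : Module.finrank ℝ ((vectorSpan ℝ b.carrier).submoduleOf (vectorSpan ℝ c.carrier))
        = p := by
      rw [(Submodule.submoduleOfEquivOfLe hle).finrank_eq, hdb]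
    refine ⟨k₁ * s * k₂, by positivity, fun m => ?_⟩
    have h0 := AlternatingMap.map_vecCons_eq_zero hle' ω
      (v := n - s • n') hu (fun i => ⟨Submodule.inclusion hle (m i), (m i).2⟩)
    have h1 : ω (Matrix.vecCons n (fun i => Submodule.inclusion hle (m i))) =
        s * ω (Matrix.vecCons n' (fun i => Submodule.inclusion hle (m i))) := by
      have h2 := (ω.curryLeft.map_sub n (s • n'))
      rw [map_smul] at h2
      have h3 := congrArg (fun ζ => ζ (fun i => Submodule.inclusion hle (m i))) h2
      simp only [AlternatingMap.curryLeft_apply_apply, AlternatingMap.sub_apply,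
        AlternatingMap.smul_apply, smul_eq_mul] at h3
      linarith [h3.symm.trans h0]
    have h4 : ω' (Matrix.vecCons n' (fun i => Submodule.inclusion hle (m i))) = k₂ * η m := by
      have := congrArg (fun ζ => ζ m) hk₂'
      exact this.symm
    rw [h1, ← hk₁', AlternatingMap.smul_apply, smul_eq_mul, h4, hε]
    ring
  · have hε : o.relOr c b = -1 := by
      unfold Orient.relOr
      rw [dif_pos h, if_neg hex]
    have hnb : (n : V) ∉ vectorSpan ℝ b.carrier := fun hb =>
      hn.ne' ((hf.eq_zero_iff _ n.2).2 hb)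
    have hζ : (ω.curryLeft n).compLinearMap (Submodule.inclusion hle) ≠ 0 := by
      intro h0
      have := AlternatingMap.curryLeft_compLinearMap_ne_zero
        (U := (vectorSpan ℝ b.carrier).submoduleOf (vectorSpan ℝ c.carrier))
        ((Submodule.submoduleOfEquivOfLe hle).finrank_eq.trans hdb) hdc hω (n := n) hnb
      apply this
      ext m
      exact congrArg (fun ζ => ζ (fun i => ⟨((m i : vectorSpan ℝ c.carrier) : V), (m i).2⟩)) h0
    -- The contraction is a nonzero top-degree form on `b`, so its ray, not being `or(b)`, is the
    -- opposite one.
    have hne : rayOfNeZero ℝ _ hζ ≠ o.or b := fun h0 =>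
      hex ⟨n, ω, hω, hζ, (hf.isOutward_iff hbI n).2 hn, hωc, h0⟩
    have hneg := (Orientation.eq_or_eq_neg (rayOfNeZero ℝ _ hζ) (o.or b)
      (by simp [hdb])).resolve_left hne
    rw [← hηb, neg_rayOfNeZero, ray_eq_iff] at hneg
    obtain ⟨k, hk, hk'⟩ := hneg.symm.exists_pos_left (neg_ne_zero.2 hη) hζ
    refine ⟨k, hk, fun m => ?_⟩
    have := congrArg (fun ζ => ζ m) hk'
    simp only [AlternatingMap.smul_apply, AlternatingMap.neg_apply, smul_eq_mul] at this
    rw [hε, show k * -1 * η m = k * - η m by ring, this]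
    rfl

end RelOr

end Polytopal

/-! ### Jumps and ellipses around a codimension-two face. -/

namespace Polytopal

/-- A piecewise constant function on the circle has vanishing total jump. -/
theorem sum_jump_eq_zero {ι : Type*} [Fintype ι] (θ j : ι → ℝ) (f : ℝ → ℝ)
    (hper : ∀ t, f (t + 2 * Real.pi) = f t)
    (hright : ∀ t, ∀ᶠ s in 𝓝[>] t, f s = f t)
    (hleft : ∀ t, ∀ᶠ s in 𝓝[<] t,
      f s = f t - ∑ i, open Classical in if ∃ k : ℤ, t = θ i + k * (2 * Real.pi) then j i else 0) :
    ∑ i, j i = 0 := by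
  classical
  have hπ : 0 < 2 * Real.pi := Real.two_pi_pos
  -- A right-continuous step function with the jumps of `f`. Then `f - N` is locally constant, hence
  -- constant, while over one period `f` returns and `N` grows by `∑ j`.
  let N : ℝ → ℝ := fun t => ∑ i, j i * ⌊(t - θ i) / (2 * Real.pi)⌋
  have hNr : ∀ t, ∀ᶠ s in 𝓝[>] t, N s = N t := by
    intro t
    have : ∀ i, ∀ᶠ s in 𝓝[>] t,
        ⌊(s - θ i) / (2 * Real.pi)⌋ = ⌊(t - θ i) / (2 * Real.pi)⌋ := by
      intro i
      have h1 : Filter.Tendsto (fun s => (s - θ i) / (2 * Real.pi)) (𝓝[>] t)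
          (𝓝[≥] ((t - θ i) / (2 * Real.pi))) := by
        refine tendsto_nhdsWithin_of_tendsto_nhds_of_eventually_within _
          (Continuous.tendsto' (by fun_prop) _ _ rfl |>.mono_left nhdsWithin_le_nhds) ?_
        filter_upwards [self_mem_nhdsWithin] with s hs
        have hs' : t < s := hs
        exact (div_le_div_iff_of_pos_right hπ).2 (by linarith)
      exact h1.eventually (Filter.tendsto_pure.1 (tendsto_floor_right_pure_floor _))
    filter_upwards [Filter.eventually_all.2 this] with s hs
    simp only [N, hs]
  have hNl : ∀ t, ∀ᶠ s in 𝓝[<] t, N s = N t -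
      ∑ i, if ∃ k : ℤ, t = θ i + k * (2 * Real.pi) then j i else 0 := by
    intro t
    have : ∀ i, ∀ᶠ s in 𝓝[<] t,
        ⌊(s - θ i) / (2 * Real.pi)⌋ = ⌈(t - θ i) / (2 * Real.pi)⌉ - 1 := by
      intro i
      have h1 : Filter.Tendsto (fun s => (s - θ i) / (2 * Real.pi)) (𝓝[<] t)
          (𝓝[<] ((t - θ i) / (2 * Real.pi))) := by
        refine tendsto_nhdsWithin_of_tendsto_nhds_of_eventually_within _
          (Continuous.tendsto' (by fun_prop) _ _ rfl |>.mono_left nhdsWithin_le_nhds) ?_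
        filter_upwards [self_mem_nhdsWithin] with s hs
        have hs' : s < t := hs
        exact (div_lt_div_iff_of_pos_right hπ).2 (by linarith)
      exact h1.eventually (Filter.tendsto_pure.1 (tendsto_floor_left_pure_ceil_sub_one _))
    filter_upwards [Filter.eventually_all.2 this] with s hs
    simp only [N, hs, ← Finset.sum_sub_distrib]
    refine Finset.sum_congr rfl fun i _ => ?_
    by_cases hk : ∃ k : ℤ, t = θ i + k * (2 * Real.pi)
    · rw [if_pos hk]
      obtain ⟨k, rfl⟩ := hk
      have : (θ i + k * (2 * Real.pi) - θ i) / (2 * Real.pi) = k := by field_simp; ring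
      rw [this]
      simp only [Int.ceil_intCast, Int.floor_intCast]
      push_cast
      ring
    · rw [if_neg hk, sub_zero]
      have : ⌈(t - θ i) / (2 * Real.pi)⌉ = ⌊(t - θ i) / (2 * Real.pi)⌋ + 1 := by
        rw [Int.ceil_eq_iff]
        push_cast
        refine ⟨?_, (Int.lt_floor_add_one _).le⟩
        rw [add_sub_cancel_right]
        refine lt_of_le_of_ne (Int.floor_le _) fun h => hk ⟨⌊(t - θ i) / (2 * Real.pi)⌋, ?_⟩
        rw [h]
        field_simp
        ring
      rw [this]
      push_cast
      ring
  have hloc : IsLocallyConstant (fun t => f t - N t) := by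
    rw [IsLocallyConstant.iff_eventually_eq]
    intro t
    rw [← nhdsNE_sup_pure, Filter.eventually_sup, ← nhdsLT_sup_nhdsGT, Filter.eventually_sup]
    refine ⟨⟨?_, ?_⟩, by simp⟩
    · filter_upwards [hleft t, hNl t] with s h1 h2
      rw [h1, h2]
      ring
    · filter_upwards [hright t, hNr t] with s h1 h2
      rw [h1, h2]
  have h := hloc.apply_eq_of_preconnectedSpace (0 + 2 * Real.pi) 0
  simp only [hper] at h
  have hN : N (0 + 2 * Real.pi) = N 0 + ∑ i, j i := by
    simp only [N, ← Finset.sum_add_distrib]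
    refine Finset.sum_congr rfl fun i _ => ?_
    have : (0 + 2 * Real.pi - θ i) / (2 * Real.pi) = (0 - θ i) / (2 * Real.pi) + 1 := by
      field_simp
      ring
    rw [this, Int.floor_add_one]
    push_cast
    ring
  linarith

section Circle

variable {V : Type*} [AddCommGroup V] [Module ℝ V]

/-- The closed curve `t ↦ cos t • u + sin t • v`. -/
noncomputable def ellipse (u v : V) (t : ℝ) : V := Real.cos t • u + Real.sin t • v

theorem ellipse_add_two_pi (u v : V) (t : ℝ) :
    ellipse u v (t + 2 * Real.pi) = ellipse u v t := by
  simp [ellipse]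

theorem ellipse_add_int_mul_two_pi (u v : V) (t : ℝ) (k : ℤ) :
    ellipse u v (t + k * (2 * Real.pi)) = ellipse u v t := by
  simp [ellipse]

theorem ellipse_add (u v : V) (s t : ℝ) :
    ellipse u v (s + t) =
      Real.cos t • ellipse u v s + Real.sin t • ellipse u v (s + Real.pi / 2) := by
  simp only [ellipse, Real.cos_add, Real.sin_add, Real.cos_pi_div_two, Real.sin_pi_div_two]
  module

theorem ellipse_mem {C : Submodule ℝ V} {u v : V} (hu : u ∈ C) (hv : v ∈ C) (t : ℝ) :
    ellipse u v t ∈ C :=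
  C.add_mem (C.smul_mem _ hu) (C.smul_mem _ hv)

theorem mem_of_ellipse_mem {C : Submodule ℝ V} {u v : V} {t : ℝ} (h : ellipse u v t ∈ C)
    (h' : ellipse u v (t + Real.pi / 2) ∈ C) (s : ℝ) : ellipse u v s ∈ C := by
  have := ellipse_add u v t (s - t)
  rw [add_sub_cancel] at this
  rw [this]
  exact C.add_mem (C.smul_mem _ h) (C.smul_mem _ h')

/-- Modulo `A`, the ellipse winds once around the origin of the plane `C / A`, in which `B / A` is a
line; `θ` is the polar angle of its half line `g < 0`. A quarter turn later the curve is off `B`,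
since otherwise `u`, `v` and `A`, hence all of `C`, would lie in `B`. -/
theorem exists_ellipse_mem {A B C : Submodule ℝ V} (hAB : A ≤ B) (hBC : B < C)
    {u v : V} (hC : ∀ w ∈ C, ∃ s t : ℝ, w - (s • u + t • v) ∈ A)
    {g : V →ₗ[ℝ] ℝ} (hg : ∀ w ∈ B, (g w = 0 ↔ w ∈ A)) (hg0 : ∃ w ∈ B, w ∉ A) :
    ∃ θ : ℝ, ellipse u v θ ∈ B ∧ g (ellipse u v θ) < 0 ∧ ellipse u v (θ + Real.pi / 2) ∉ B ∧
      ∀ t, (ellipse u v t ∈ B ∧ g (ellipse u v t) ≤ 0) ↔ ∃ k : ℤ, t = θ + k * (2 * Real.pi) := by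
  obtain ⟨w, hw, hgw⟩ : ∃ w ∈ B, g w < 0 := by
    obtain ⟨w, hw, hwA⟩ := hg0
    rcases lt_or_gt_of_ne (fun h => hwA ((hg w hw).1 h)) with h | h
    · exact ⟨w, hw, h⟩
    · exact ⟨-w, B.neg_mem hw, by simpa using h⟩
  obtain ⟨s, t, hst⟩ := hC w (hBC.le hw)
  have hstB : s • u + t • v ∈ B := by
    have := B.sub_mem hw (hAB hst)
    rwa [sub_sub_cancel] at this
  have hgst : g (s • u + t • v) < 0 := by
    have := (hg _ (hAB hst)).2 hst
    rw [map_sub] at this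
    linarith
  let z : ℂ := ⟨s, t⟩
  have hz : z ≠ 0 := by
    intro h0
    have hs : s = 0 := congrArg Complex.re h0
    have ht : t = 0 := congrArg Complex.im h0
    rw [hs, ht] at hgst
    simp at hgst
  have hz' : 0 < ‖z‖ := norm_pos_iff.2 hz
  have hell : s • u + t • v = ‖z‖ • ellipse u v z.arg := by
    have h1 : ‖z‖ * Real.cos z.arg = s := Complex.norm_mul_cos_arg z
    have h2 : ‖z‖ * Real.sin z.arg = t := Complex.norm_mul_sin_arg z
    rw [ellipse, smul_add, smul_smul, smul_smul, h1, h2]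
  rw [hell] at hstB hgst
  have hB : ellipse u v z.arg ∈ B := (B.smul_mem_iff hz'.ne').1 hstB
  have hgB : g (ellipse u v z.arg) < 0 := by
    rw [map_smul, smul_eq_mul] at hgst
    nlinarith
  have hB' : ellipse u v (z.arg + Real.pi / 2) ∉ B := by
    intro h'
    refine hBC.not_ge fun w hw => ?_
    obtain ⟨s, t, hst⟩ := hC w hw
    have hu : u ∈ B := by simpa [ellipse] using mem_of_ellipse_mem hB h' 0
    have hv : v ∈ B := by simpa [ellipse] using mem_of_ellipse_mem hB h' (Real.pi / 2)
    have := B.add_mem (hAB hst) (B.add_mem (B.smul_mem s hu) (B.smul_mem t hv))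
    rwa [sub_add_cancel] at this
  refine ⟨z.arg, hB, hgB, hB', fun t => ⟨?_, ?_⟩⟩
  · rintro ⟨h1, h2⟩
    have h3 := ellipse_add u v z.arg (t - z.arg)
    rw [add_sub_cancel] at h3
    have hsin : Real.sin (t - z.arg) = 0 := by
      by_contra hne
      apply hB'
      rw [h3, Submodule.add_mem_iff_right _ (B.smul_mem _ hB)] at h1
      exact (B.smul_mem_iff hne).1 h1
    rw [h3, hsin, zero_smul, add_zero, map_smul, smul_eq_mul] at h2
    have hcos : 0 ≤ Real.cos (t - z.arg) := by
      by_contra! hneg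
      nlinarith
    have hcos1 : Real.cos (t - z.arg) = 1 := by
      rcases Real.sin_eq_zero_iff_cos_eq.1 hsin with h | h
      · exact h
      · linarith
    obtain ⟨k, hk⟩ := (Real.cos_eq_one_iff _).1 hcos1
    exact ⟨k, by linarith⟩
  · rintro ⟨k, rfl⟩
    rw [ellipse_add_int_mul_two_pi]
    exact ⟨hB, hgB.le⟩

theorem exists_complementary_pair [FiniteDimensional ℝ V] {A C : Submodule ℝ V} (hAC : A ≤ C)
    (hd : Module.finrank ℝ A + 2 = Module.finrank ℝ C) :
    ∃ u ∈ C, ∃ v ∈ C, ∀ w ∈ C, ∃ s t : ℝ, w - (s • u + t • v) ∈ A := by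
  have h2 : Module.finrank ℝ (C ⧸ A.submoduleOf C) = 2 := by
    have := Submodule.finrank_quotient_add_finrank (A.submoduleOf C)
    rw [(Submodule.submoduleOfEquivOfLe hAC).finrank_eq] at this
    omega
  let e := Module.finBasisOfFinrankEq ℝ _ h2
  obtain ⟨u, hu⟩ := Submodule.mkQ_surjective _ (e 0)
  obtain ⟨v, hv⟩ := Submodule.mkQ_surjective _ (e 1)
  refine ⟨u, u.2, v, v.2, fun w hw => ?_⟩
  have h := e.sum_repr (Submodule.mkQ _ ⟨w, hw⟩)
  rw [Fin.sum_univ_two, ← hu, ← hv, ← map_smul, ← map_smul, ← map_add, eq_comm,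
    ← sub_eq_zero, ← map_sub, Submodule.mkQ_apply, Submodule.Quotient.mk_eq_zero] at h
  exact ⟨_, _, h⟩

end Circle

end Polytopal

namespace Polytopal

/-! ### Contracting a form by two vectors. -/

section DoubleContraction

variable {W : Type*} [AddCommGroup W] [Module ℝ W] {p : ℕ}

/-- The bilinear form obtained from an alternating form by fixing all but the first two
arguments. -/
def contractTail (γ : W [⋀^Fin (p + 2)]→ₗ[ℝ] ℝ) (m : Fin p → W) : W →ₗ[ℝ] W →ₗ[ℝ] ℝ :=
  LinearMap.mk₂ ℝ (fun x y => γ (Matrix.vecCons x (Matrix.vecCons y m)))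
    (fun x x' y => congrArg (fun ζ => ζ (Matrix.vecCons y m)) (γ.curryLeft.map_add x x'))
    (fun r x y => congrArg (fun ζ => ζ (Matrix.vecCons y m)) (γ.curryLeft.map_smul r x))
    (fun x y y' => congrArg (fun ζ => ζ m) ((γ.curryLeft x).curryLeft.map_add y y'))
    (fun r x y => congrArg (fun ζ => ζ m) ((γ.curryLeft x).curryLeft.map_smul r y))

theorem contractTail_apply (γ : W [⋀^Fin (p + 2)]→ₗ[ℝ] ℝ) (m : Fin p → W) (x y : W) :
    contractTail γ m x y = γ (Matrix.vecCons x (Matrix.vecCons y m)) := rfl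

theorem contractTail_self (γ : W [⋀^Fin (p + 2)]→ₗ[ℝ] ℝ) (m : Fin p → W) (x : W) :
    contractTail γ m x x = 0 :=
  γ.map_eq_zero_of_eq _ (i := 0) (j := 1) rfl (by simp)

theorem contractTail_swap (γ : W [⋀^Fin (p + 2)]→ₗ[ℝ] ℝ) (m : Fin p → W) (x y : W) :
    contractTail γ m x y = - contractTail γ m y x := by
  have := contractTail_self γ m (x + y)
  simp only [map_add, LinearMap.add_apply, contractTail_self] at this
  linarith

/-- An area form is invariant under rotation. This gives all crossings the same constant. -/
theorem contractTail_ellipse (γ : W [⋀^Fin (p + 2)]→ₗ[ℝ] ℝ) (m : Fin p → W) (u v : W) (t : ℝ) :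
    contractTail γ m (ellipse u v t) (ellipse u v (t + Real.pi / 2)) = contractTail γ m u v := by
  simp only [ellipse, Real.cos_add_pi_div_two, Real.sin_add_pi_div_two, map_add, map_smul,
    LinearMap.add_apply, LinearMap.smul_apply, contractTail_self, smul_eq_mul,
    contractTail_swap γ m v u]
  linear_combination (contractTail γ m u v) * Real.sin_sq_add_cos_sq t

theorem contractTail_ne_zero [FiniteDimensional ℝ W] (hW : Module.finrank ℝ W = p + 2)
    {γ : W [⋀^Fin (p + 2)]→ₗ[ℝ] ℝ} (hγ : γ ≠ 0) {m : Fin p → W} {u v : W}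
    (h : ∀ w, ∃ s t : ℝ, w - (s • u + t • v) ∈ Submodule.span ℝ (Set.range m)) :
    contractTail γ m u v ≠ 0 := by
  have hspan : ⊤ ≤ Submodule.span ℝ (Set.range (Matrix.vecCons u (Matrix.vecCons v m))) := by
    intro w _
    obtain ⟨s, t, hst⟩ := h w
    rw [← sub_add_cancel w (s • u + t • v)]
    simp only [Matrix.range_cons]
    refine Submodule.add_mem _ (Submodule.span_mono ?_ hst)
      (Submodule.add_mem _ (Submodule.smul_mem _ _ (Submodule.subset_span ?_))
        (Submodule.smul_mem _ _ (Submodule.subset_span ?_)))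
    · exact Set.subset_union_right.trans Set.subset_union_right
    · simp
    · simp
  have := (AlternatingMap.map_basis_ne_zero_iff
    (basisOfTopLeSpanOfCardEqFinrank _ hspan (by simp [hW])) γ).2 hγ
  rwa [coe_basisOfTopLeSpanOfCardEqFinrank] at this

end DoubleContraction

/-! ### Cancellation of signs around a codimension-two face, and `∂∂ = 0`. -/

section Diamond

variable {V P : Type*} [NormedAddCommGroup V] [NormedSpace ℝ V]
  [MetricSpace P] [NormedAddTorsor V P] {K : Mesh P}

/-- Contract `γ` first by `±z'`, outward along `b`, then by `-z`, outward from `b` along `a`.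
Swapping the two arguments absorbs the minus sign, and the orientation of `b` drops out. -/
theorem Orient.exists_pos_relOr_mul_relOr [FiniteDimensional ℝ V] (o : Orient K) {p : ℕ}
    {c : K.Cell (p + 2)} {b : K.Cell (p + 1)}
    {a : K.Cell p} (hbc : b.Hyperface c) (hab : a.Hyperface b) {f g : V →ₗ[ℝ] ℝ}
    (hf : IsBounding c.carrier b.carrier f) (hg : IsBounding b.carrier a.carrier g)
    (z z' : vectorSpan ℝ c.carrier) (hz : (z : V) ∈ vectorSpan ℝ b.carrier) (hgz : g z < 0)
    (hz' : f z' ≠ 0)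
    {γ : vectorSpan ℝ c.carrier [⋀^Fin (p + 2)]→ₗ[ℝ] ℝ} (hγ : γ ≠ 0)
    (hγc : rayOfNeZero ℝ γ hγ = o.or c)
    {α : vectorSpan ℝ a.carrier [⋀^Fin p]→ₗ[ℝ] ℝ} (hα : α ≠ 0)
    (hαa : rayOfNeZero ℝ α hα = o.or a) (m : Fin p → vectorSpan ℝ a.carrier) :
    ∃ k : ℝ, 0 < k ∧ k * (o.relOr c b * o.relOr b a) * α m =
      Real.sign (f z') * contractTail γ (fun i => Submodule.inclusion
        (vectorSpan_mono ℝ (hab.subset.trans hbc.subset)) (m i)) z z' := by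
  have hσ : 0 < f (Real.sign (f z') • (z' : V)) := by
    rw [map_smul, smul_eq_mul]
    exact Real.sign_mul_pos_of_ne_zero _ hz'
  let n : vectorSpan ℝ b.carrier := -⟨z, hz⟩
  have hn : 0 < g n := by
    simpa [n] using hgz
  obtain ⟨k, hk, h1⟩ := o.exists_pos_contraction_eq hbc hf (Real.sign (f z') • z') hσ hγ hγc
    (o.or b).someVector_ne_zero (o.or b).someVector_ray
  obtain ⟨k', hk', h2⟩ := o.exists_pos_contraction_eq hab hg n hn
    (o.or b).someVector_ne_zero (o.or b).someVector_ray hα hαa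
  have h3 := h1 (Matrix.vecCons n
    (fun i => Submodule.inclusion (vectorSpan_mono ℝ hab.subset) (m i)))
  rw [h2 m] at h3
  refine ⟨k * k', mul_pos hk hk', ?_⟩
  have h4 : (fun i => Submodule.inclusion (vectorSpan_mono ℝ hbc.subset)
      ((Matrix.vecCons n (fun i => Submodule.inclusion (vectorSpan_mono ℝ hab.subset) (m i)) :
        Fin (p + 1) → vectorSpan ℝ b.carrier) i)) =
      Matrix.vecCons (-z) (fun i => Submodule.inclusion
        (vectorSpan_mono ℝ (hab.subset.trans hbc.subset)) (m i)) := by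
    funext i
    refine Fin.cases ?_ (fun j => ?_) i
    · rfl
    · rfl
  rw [h4, ← contractTail_apply, contractTail_swap] at h3
  simp only [map_neg, map_smul, LinearMap.neg_apply, smul_eq_mul] at h3
  linear_combination -h3

namespace Mesh

theorem isClosed_intrinsicFrontier {X : Set P} (hX : X ∈ K.cells) :
    IsClosed (intrinsicFrontier ℝ X) := by
  rw [K.boundary_eq X hX]
  rw [Set.sUnion_eq_biUnion]
  exact (K.finite_cells.subset fun Y hY => hY.1).isClosed_biUnion fun Y hY => K.isClosed hY.1

/-- The local picture of a `(p + 2)`-cell `c` near a relative interior point of one of its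
`p`-faces `a`. -/
theorem exists_pos_local_picture {p : ℕ} (a : K.Cell p) (c : K.Cell (p + 2))
    {x : P} (hx : x ∈ intrinsicInterior ℝ a.carrier) {g : K.Cell (p + 1) → V →ₗ[ℝ] ℝ}
    (hg : ∀ b, a.Hyperface b → IsBounding b.carrier a.carrier (g b)) :
    ∃ r > 0,
      (∀ v : V, ‖v‖ < r → (v +ᵥ x ∈ intrinsicFrontier ℝ c.carrier ↔
        ∃ b : K.Cell (p + 1), b.Hyperface c ∧ a.Hyperface b ∧ v +ᵥ x ∈ b.carrier)) ∧
      ∀ b : K.Cell (p + 1), a.Hyperface b → ∀ v ∈ vectorSpan ℝ b.carrier, ‖v‖ < r →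
        (v +ᵥ x ∈ b.carrier ↔ g b v ≤ 0) ∧
          (v +ᵥ x ∈ intrinsicInterior ℝ b.carrier ↔ g b v < 0) := by
  obtain ⟨r₀, hr₀, h₀⟩ := exists_pos_frontier_iff (V := V) (X := c.carrier) c.2.1 x
  have h₁ : ∀ b : K.Cell (p + 1), ∃ r > 0, a.Hyperface b →
      ∀ v ∈ vectorSpan ℝ b.carrier, ‖v‖ < r →
        (v +ᵥ x ∈ b.carrier ↔ g b v ≤ 0) ∧
          (v +ᵥ x ∈ intrinsicInterior ℝ b.carrier ↔ g b v < 0) := by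
    intro b
    by_cases hb : a.Hyperface b
    · obtain ⟨r, hr, h⟩ := (hg b hb).isHalfSpaceNear x hx
      exact ⟨r, hr, fun _ => h⟩
    · exact ⟨1, one_pos, fun h => absurd h hb⟩
  choose ρ hρ h₁ using h₁
  obtain ⟨r, ⟨hr0, hrρ⟩, hr⟩ := ((((eventually_nhdsWithin_of_eventually_nhds
    (eventually_lt_nhds hr₀)).and (Filter.eventually_all.2 fun b =>
      eventually_nhdsWithin_of_eventually_nhds (eventually_lt_nhds (hρ b)))).and
        (self_mem_nhdsWithin (s := Set.Ioi (0 : ℝ))))).exists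
  refine ⟨r, hr, fun v hv => ?_, fun b hb v hvb hv => h₁ b hb v hvb (hv.trans (hrρ b))⟩
  rw [h₀ v (hv.trans hr0)]
  constructor
  · rintro ⟨Y, hY, hxY, hvY⟩
    have hdY : dim Y = p + 1 := by
      have h1 := hY.2.2.1
      have h2 : dim (Cell.carrier c) = p + 2 := c.2.2
      omega
    refine ⟨⟨Y, hY.1, hdY⟩, hY, ?_, hvY⟩
    refine (isFace_of_mem_intrinsicInterior hY.1 a.2.1 hx hxY).isHyperface ?_
    rw [hdY]
    exact congrArg (· + 1) a.2.2
  · rintro ⟨b, hbc, hab, hvb⟩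
    exact ⟨b.carrier, hbc, hab.subset (intrinsicInterior_subset hx), hvb⟩

end Mesh

end Diamond

end Polytopal

namespace Polytopal

section Diamond

variable {V P : Type*} [NormedAddCommGroup V] [NormedSpace ℝ V] [FiniteDimensional ℝ V]
  [MetricSpace P] [NormedAddTorsor V P] {K : Mesh P}

omit [FiniteDimensional ℝ V] in
theorem norm_ellipse_le (u v : V) (t : ℝ) : ‖ellipse u v t‖ ≤ ‖u‖ + ‖v‖ := by
  refine (norm_add_le _ _).trans (add_le_add ?_ ?_)
  · rw [norm_smul]
    exact mul_le_of_le_one_left (norm_nonneg _) (Real.abs_cos_le_one t)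
  · rw [norm_smul]
    exact mul_le_of_le_one_left (norm_nonneg _) (Real.abs_sin_le_one t)

omit [FiniteDimensional ℝ V] in
theorem continuous_ellipse (u v : V) : Continuous (ellipse u v) := by
  unfold ellipse
  fun_prop

omit [FiniteDimensional ℝ V] in
/-- If `ellipse u v t +ᵥ x` is a relative interior point of a hyperface `b` of `c`, then the curve
`ellipse u v +ᵥ x` crosses `b` at the parameter `t`. -/
theorem IsBounding.eventually_ellipse {c b : Set P} {f : V →ₗ[ℝ] ℝ} (hf : IsBounding c b f)
    {u v : V} (hu : u ∈ vectorSpan ℝ c) (hv : v ∈ vectorSpan ℝ c) {t : ℝ}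
    (ht : ellipse u v t ∈ vectorSpan ℝ b) {x : P}
    (hx : ellipse u v t +ᵥ x ∈ intrinsicInterior ℝ b) :
    ∀ᶠ s in 𝓝 t,
      (ellipse u v s +ᵥ x ∈ c ↔ Real.sin (s - t) * f (ellipse u v (t + Real.pi / 2)) ≤ 0) ∧
      (ellipse u v s +ᵥ x ∈ intrinsicInterior ℝ c ↔
        Real.sin (s - t) * f (ellipse u v (t + Real.pi / 2)) < 0) := by
  obtain ⟨r, hr, h⟩ := hf.isHalfSpaceNear _ hx
  have hft : f (ellipse u v t) = 0 := (hf.eq_zero_iff _ (ellipse_mem hu hv t)).2 ht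
  have hcont : Continuous fun s => ‖ellipse u v s - ellipse u v t‖ :=
    ((continuous_ellipse u v).sub continuous_const).norm
  filter_upwards [hcont.tendsto t (Iio_mem_nhds (by simpa using hr))] with s hs
  have := h _ (Submodule.sub_mem _ (ellipse_mem hu hv s) (ellipse_mem hu hv t)) hs
  rw [vadd_vadd, sub_add_cancel, map_sub, hft, sub_zero] at this
  -- Expand the curve at `t`: the cosine term is killed by `f`, so the sign of `f` is that of the
  -- sine term.
  have h3 := ellipse_add u v t (s - t)
  rw [add_sub_cancel] at h3
  rw [h3] at this ⊢
  simpa only [map_add, map_smul, hft, smul_eq_mul, mul_zero, zero_add] using this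

theorem Mesh.exists_ellipse {p : ℕ} (a : K.Cell p) (c : K.Cell (p + 2))
    (hac : vectorSpan ℝ a.carrier ≤ vectorSpan ℝ c.carrier) {r : ℝ} (hr : 0 < r) :
    ∃ u ∈ vectorSpan ℝ c.carrier, ∃ v ∈ vectorSpan ℝ c.carrier,
      (∀ w ∈ vectorSpan ℝ c.carrier,
        ∃ s t : ℝ, w - (s • u + t • v) ∈ vectorSpan ℝ a.carrier) ∧
      ∀ t, ‖ellipse u v t‖ < r := by
  obtain ⟨u, hu, v, hv, h⟩ := exists_complementary_pair hac
    ((congrArg (· + 2) a.2.2).trans c.2.2.symm)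
  let k : ℝ := r / (‖u‖ + ‖v‖ + 1)
  have hk : 0 < k := by positivity
  refine ⟨k • u, Submodule.smul_mem _ _ hu, k • v, Submodule.smul_mem _ _ hv, fun w hw => ?_,
    fun t => (norm_ellipse_le _ _ t).trans_lt ?_⟩
  · obtain ⟨s, t, hst⟩ := h w hw
    refine ⟨s / k, t / k, ?_⟩
    rwa [smul_smul, smul_smul, div_mul_cancel₀ _ hk.ne', div_mul_cancel₀ _ hk.ne']
  · rw [norm_smul, norm_smul, Real.norm_of_nonneg hk.le, ← mul_add]
    simp only [k]
    rw [div_mul_eq_mul_div, div_lt_iff₀ (by positivity)]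
    nlinarith [norm_nonneg u, norm_nonneg v]

omit [FiniteDimensional ℝ V] in
/-- The curve `ellipse u v` around a relative interior point of a `p`-cell `a`, in a
`(p + 2)`-cell `c`, crosses the boundary of `c` with vanishing total sign. -/
theorem Mesh.sum_sign_eq_zero {p : ℕ} (c : K.Cell (p + 2)) {x : P}
    {u v : V} (hu : u ∈ vectorSpan ℝ c.carrier) (hv : v ∈ vectorSpan ℝ c.carrier)
    {ι : Type*} [Fintype ι] (b : ι → K.Cell (p + 1)) (hb : Function.Injective b)
    (hx : ∀ i, x ∈ (b i).carrier)
    (f : ι → V →ₗ[ℝ] ℝ) (hf : ∀ i, IsBounding c.carrier (b i).carrier (f i)) (θ : ι → ℝ)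
    (hfr : ∀ t, ellipse u v t +ᵥ x ∈ intrinsicFrontier ℝ c.carrier ↔
      ∃ i, ellipse u v t +ᵥ x ∈ (b i).carrier)
    (hθ : ∀ i t, ellipse u v t +ᵥ x ∈ (b i).carrier ↔ ∃ k : ℤ, t = θ i + k * (2 * Real.pi))
    (hint : ∀ i, ellipse u v (θ i) +ᵥ x ∈ intrinsicInterior ℝ (b i).carrier)
    (hne : ∀ i, f i (ellipse u v (θ i + Real.pi / 2)) ≠ 0) :
    ∑ i, Real.sign (f i (ellipse u v (θ i + Real.pi / 2))) = 0 := by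
  classical
  set z := ellipse u v with hz
  have hzc : ∀ t, z t ∈ vectorSpan ℝ c.carrier := ellipse_mem hu hv
  -- the indicator of the interior of `c` along the curve, made right-continuous
  let F : ℝ → ℝ := fun t => if z t +ᵥ x ∈ intrinsicInterior ℝ c.carrier ∨
    ∃ i, (∃ k : ℤ, t = θ i + k * (2 * Real.pi)) ∧ f i (z (θ i + Real.pi / 2)) < 0 then 1 else 0
  have hF1 : ∀ t, z t +ᵥ x ∈ intrinsicInterior ℝ c.carrier → F t = 1 := fun t ht =>
    if_pos (Or.inl ht)
  have hfr' : ∀ t, z t +ᵥ x ∈ intrinsicFrontier ℝ c.carrier ↔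
      ∃ i, ∃ k : ℤ, t = θ i + k * (2 * Real.pi) := fun t => by
    rw [hfr t]
    exact exists_congr fun i => hθ i t
  have hF0 : ∀ t, z t +ᵥ x ∉ intrinsicFrontier ℝ c.carrier →
      z t +ᵥ x ∉ intrinsicInterior ℝ c.carrier → F t = 0 := by
    intro t ht ht'
    refine if_neg ?_
    rintro (h | ⟨i, h, -⟩)
    · exact ht' h
    · exact ht ((hfr' t).2 ⟨i, h⟩)
  -- regular parameters
  have hreg : ∀ t, (¬ ∃ i, ∃ k : ℤ, t = θ i + k * (2 * Real.pi)) → ∀ᶠ s in 𝓝 t, F s = F t := by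
    intro t ht
    have htf : z t +ᵥ x ∉ intrinsicFrontier ℝ c.carrier := fun h => ht ((hfr' t).1 h)
    have hzcont : Continuous fun s => z s +ᵥ x := (continuous_ellipse u v).vadd continuous_const
    have h1 : ∀ᶠ s in 𝓝 t, z s +ᵥ x ∉ intrinsicFrontier ℝ c.carrier :=
      ((isClosed_intrinsicFrontier c.2.1).preimage hzcont).isOpen_compl.mem_nhds htf
    have h2 : Filter.Tendsto z (𝓝 t) (𝓝[vectorSpan ℝ c.carrier] (z t)) :=
      tendsto_nhdsWithin_of_tendsto_nhds_of_eventually_within _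
        ((continuous_ellipse u v).tendsto t) (Filter.Eventually.of_forall hzc)
    filter_upwards [h1, h2.eventually
      (eventually_mem_intrinsicInterior_iff c.2.1 (hzc t) htf subset_rfl)] with s hs1 hs2
    by_cases h3 : z t +ᵥ x ∈ intrinsicInterior ℝ c.carrier
    · rw [hF1 t h3, hF1 s (hs2.2 h3)]
    · rw [hF0 t htf h3, hF0 s hs1 (fun h => h3 (hs2.1 h))]
  -- crossing parameters
  have hper : ∀ (t : ℝ) (k : ℤ), z (t + k * (2 * Real.pi)) = z t := ellipse_add_int_mul_two_pi u v
  -- A crossing point is relative interior in its hyperface, so no other cell of that dimension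
  -- contains it.
  have huniq : ∀ i i' t, (∃ k : ℤ, t = θ i + k * (2 * Real.pi)) →
      (∃ k : ℤ, t = θ i' + k * (2 * Real.pi)) → i = i' := by
    rintro i i' t ⟨k, rfl⟩ h'
    have h1 := (hθ i' _).2 h'
    have h2 := hint i
    rw [hper] at h1
    have h3 := (isFace_of_mem_intrinsicInterior (b i').2.1 (b i).2.1 h2 h1).eq_of_dim_eq
      ((b i).2.2.trans (b i').2.2.symm)
    exact hb (Subtype.ext h3)
  have hcross : ∀ i (k : ℤ), (F (θ i + k * (2 * Real.pi)) =
        if f i (z (θ i + Real.pi / 2)) < 0 then 1 else 0) ∧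
      ∀ᶠ s in 𝓝[≠] (θ i + k * (2 * Real.pi)), F s =
        if Real.sin (s - (θ i + k * (2 * Real.pi))) * f i (z (θ i + Real.pi / 2)) < 0
          then 1 else 0 := by
    intro i k
    set t := θ i + k * (2 * Real.pi) with ht
    have htπ : z (t + Real.pi / 2) = z (θ i + Real.pi / 2) := by
      rw [← hper (θ i + Real.pi / 2) k]
      congr 1
      rw [ht]
      ring
    constructor
    · have h1 : z t +ᵥ x ∉ intrinsicInterior ℝ c.carrier :=
        ((K.mem_intrinsicFrontier_iff c.2.1).1 ((hfr' t).2 ⟨i, k, rfl⟩)).2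
      simp only [F]
      refine if_congr ⟨?_, fun h => Or.inr ⟨i, ⟨k, rfl⟩, h⟩⟩ rfl rfl
      rintro (h | ⟨i', h, h'⟩)
      · exact absurd h h1
      · rwa [huniq i i' t ⟨k, rfl⟩ h]
    · have h1 : z t +ᵥ x ∈ intrinsicInterior ℝ (b i).carrier := by rw [ht, hper]; exact hint i
      have h2 := (hf i).eventually_ellipse hu hv
        (mem_vectorSpan_of_vadd_mem (hx i) (intrinsicInterior_subset h1)) h1
      have h3 : ∀ᶠ s in 𝓝[≠] t, Real.sin (s - t) ≠ 0 := by
        filter_upwards [self_mem_nhdsWithin, mem_nhdsWithin_of_mem_nhds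
          (Metric.ball_mem_nhds t Real.pi_pos)] with s hs1 hs2
        rw [Metric.mem_ball, Real.dist_eq, abs_lt] at hs2
        rw [Ne, Real.sin_eq_zero_iff_of_lt_of_lt hs2.1 hs2.2, sub_eq_zero]
        exact hs1
      filter_upwards [mem_nhdsWithin_of_mem_nhds h2, h3] with s hs hs'
      rw [← hz, htπ] at hs
      split_ifs with h4
      · exact hF1 s (hs.2.2 h4)
      · have h5 : ¬ Real.sin (s - t) * f i (z (θ i + Real.pi / 2)) ≤ 0 := fun h5 =>
          h4 (lt_of_le_of_ne h5 (mul_ne_zero hs' (hne i)))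
        refine hF0 s (fun h => h5 (hs.1.1 ?_)) (fun h => h4 (hs.2.1 h))
        exact ((K.mem_intrinsicFrontier_iff c.2.1).1 h).1
  have hsin_right : ∀ t : ℝ, ∀ᶠ s in 𝓝[>] t, 0 < Real.sin (s - t) := by
    intro t
    filter_upwards [Ioo_mem_nhdsGT (show t < t + Real.pi by linarith [Real.pi_pos])] with s hs
    exact Real.sin_pos_of_pos_of_lt_pi (by linarith [hs.1]) (by linarith [hs.2])
  have hsin_left : ∀ t : ℝ, ∀ᶠ s in 𝓝[<] t, Real.sin (s - t) < 0 := by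
    intro t
    filter_upwards [Ioo_mem_nhdsLT (show t - Real.pi < t by linarith [Real.pi_pos])] with s hs
    exact Real.sin_neg_of_neg_of_neg_pi_lt (by linarith [hs.2]) (by linarith [hs.1])
  -- Where `f` increases along the curve, the curve leaves `c` and `F` drops from 1 to 0; this
  -- accounts for the minus sign.
  have key := sum_jump_eq_zero θ (fun i => - Real.sign (f i (z (θ i + Real.pi / 2)))) F
    (fun t => by
      have h1 : z (t + 2 * Real.pi) = z t := ellipse_add_two_pi u v t
      simp only [F, h1]
      refine if_congr (or_congr Iff.rfl (exists_congr fun i => and_congr ?_ Iff.rfl)) rfl rfl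
      rw [← hθ, ← hθ, h1])
    (fun t => by
      by_cases ht : ∃ i, ∃ k : ℤ, t = θ i + k * (2 * Real.pi)
      · obtain ⟨i, k, rfl⟩ := ht
        filter_upwards [nhdsGT_le_nhdsNE _ (hcross i k).2, hsin_right _] with s hs1 hs2
        rw [hs1, (hcross i k).1]
        refine if_congr ⟨fun h => ?_, fun h => mul_neg_of_pos_of_neg hs2 h⟩ rfl rfl
        by_contra! h'
        exact h.not_ge (mul_nonneg hs2.le h')
      · exact mem_nhdsWithin_of_mem_nhds (hreg t ht))
    (fun t => by
      by_cases ht : ∃ i, ∃ k : ℤ, t = θ i + k * (2 * Real.pi)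
      · obtain ⟨i, k, hk⟩ := ht
        have hsum : (∑ i', if ∃ k : ℤ, t = θ i' + k * (2 * Real.pi)
            then - Real.sign (f i' (z (θ i' + Real.pi / 2))) else 0) =
            - Real.sign (f i (z (θ i + Real.pi / 2))) := by
          rw [Finset.sum_eq_single i, if_pos ⟨k, hk⟩]
          · intro i' _ hi'
            exact if_neg fun h => hi' (huniq i' i t h ⟨k, hk⟩)
          · simp
        rw [hsum]
        subst hk
        filter_upwards [nhdsLT_le_nhdsNE _ (hcross i k).2, hsin_left _] with s hs1 hs2
        rw [hs1, (hcross i k).1]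
        rcases lt_or_gt_of_ne (hne i) with h | h
        · rw [if_pos h, if_neg (mul_pos_of_neg_of_neg hs2 h).not_gt, Real.sign_of_neg h]
          norm_num
        · rw [if_neg h.not_gt, if_pos (mul_neg_of_neg_of_pos hs2 h), Real.sign_of_pos h]
          norm_num
      · have hsum : (∑ i', if ∃ k : ℤ, t = θ i' + k * (2 * Real.pi)
            then - Real.sign (f i' (z (θ i' + Real.pi / 2))) else 0) = 0 :=
          Finset.sum_eq_zero fun i' _ => if_neg fun h => ht ⟨i', h⟩
        rw [hsum, sub_zero]
        exact mem_nhdsWithin_of_mem_nhds (hreg t ht))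
  rw [Finset.sum_neg_distrib, neg_eq_zero] at key
  exact key

/-- Each product is a crossing sign of the ellipse times a sign independent of `b`, and the crossing
signs add up to zero. -/
theorem Orient.sum_relOr_mul_relOr (o : Orient K) {p : ℕ} (c : K.Cell (p + 2)) (a : K.Cell p) :
    ∑ b : K.Cell (p + 1), o.relOr c b * o.relOr b a = 0 := by
  classical
  let ι := {b : K.Cell (p + 1) // b.Hyperface c ∧ a.Hyperface b}
  let _ : Fintype ι := Fintype.ofFinite _
  have hred : ∑ b : K.Cell (p + 1), o.relOr c b * o.relOr b a =
      ∑ i : ι, o.relOr c i.1 * o.relOr i.1 a := by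
    symm
    refine Fintype.sum_of_injective (fun i : ι => i.1) Subtype.val_injective _ _ ?_
      (fun _ => rfl)
    intro b hb
    by_cases h1 : b.Hyperface c
    · have h2 : ¬ a.Hyperface b := fun h2 => hb ⟨⟨b, h1, h2⟩, rfl⟩
      rw [o.relOr_of_not_hyperface h2, mul_zero]
    · rw [o.relOr_of_not_hyperface h1, zero_mul]
  rw [hred]
  rcases isEmpty_or_nonempty ι with hι | ⟨⟨i₀⟩⟩
  · exact Finset.sum_of_isEmpty _
  have hac := i₀.2.2.subset.trans i₀.2.1.subset
  have hVac := vectorSpan_mono ℝ hac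
  obtain ⟨x, hx⟩ := (K.isFlatBall a.carrier a.2.1).nonempty_intrinsicInterior
  have hxa := intrinsicInterior_subset hx
  have hg : ∀ b : K.Cell (p + 1), ∃ g : V →ₗ[ℝ] ℝ, a.Hyperface b →
      IsBounding b.carrier a.carrier g := fun b => by
    by_cases h : a.Hyperface b
    · obtain ⟨g, hg⟩ := Mesh.exists_isBounding h
      exact ⟨g, fun _ => hg⟩
    · exact ⟨0, fun h' => absurd h' h⟩
  choose g hg using hg
  have hf : ∀ i : ι, ∃ f : V →ₗ[ℝ] ℝ, IsBounding c.carrier i.1.carrier f :=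
    fun i => Mesh.exists_isBounding i.2.1
  choose f hf using hf
  obtain ⟨r, hr, hfr, hloc⟩ := Mesh.exists_pos_local_picture a c hx hg
  obtain ⟨u, hu, v, hv, huv, hnorm⟩ := Mesh.exists_ellipse a c hVac hr
  have hθ : ∀ i : ι, ∃ θ : ℝ, ellipse u v θ ∈ vectorSpan ℝ i.1.carrier ∧
      g i.1 (ellipse u v θ) < 0 ∧
      ellipse u v (θ + Real.pi / 2) ∉ vectorSpan ℝ i.1.carrier ∧
      ∀ t, (ellipse u v t ∈ vectorSpan ℝ i.1.carrier ∧ g i.1 (ellipse u v t) ≤ 0) ↔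
        ∃ k : ℤ, t = θ + k * (2 * Real.pi) := by
    intro i
    refine exists_ellipse_mem (vectorSpan_mono ℝ i.2.2.subset)
      (lt_of_le_of_ne (vectorSpan_mono ℝ i.2.1.subset) fun h => ?_) huv (hg i.1 i.2.2).eq_zero_iff
      (Mesh.exists_notMem_vectorSpan i.2.2)
    have h1 := i.2.1.2.2.1
    unfold dim at h1
    rw [h] at h1
    omega
  choose θ hθ1 hθ2 hθ3 hθ4 using hθ
  have hne : ∀ i, f i (ellipse u v (θ i + Real.pi / 2)) ≠ 0 := fun i h0 =>
    hθ3 i (((hf i).eq_zero_iff _ (ellipse_mem hu hv _)).1 h0)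
  have hsign := Mesh.sum_sign_eq_zero c hu hv (fun i : ι => i.1) Subtype.val_injective
    (fun i => i.2.2.subset hxa) f hf θ
    (fun t => (hfr _ (hnorm t)).trans
      ⟨fun ⟨b, h1, h2, h3⟩ => ⟨⟨b, h1, h2⟩, h3⟩, fun ⟨i, h3⟩ => ⟨i.1, i.2.1, i.2.2, h3⟩⟩)
    (fun i t => by
      rw [← hθ4 i t]
      constructor
      · intro h
        have h1 := mem_vectorSpan_of_vadd_mem (i.2.2.subset hxa) h
        exact ⟨h1, (hloc i.1 i.2.2 _ h1 (hnorm t)).1.1 h⟩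
      · rintro ⟨h1, h2⟩
        exact (hloc i.1 i.2.2 _ h1 (hnorm t)).1.2 h2)
    (fun i => (hloc i.1 i.2.2 _ (hθ1 i) (hnorm _)).2.2 (hθ2 i)) hne
  -- comparison of the signs with the incidence numbers
  let e := Module.finBasisOfFinrankEq ℝ (vectorSpan ℝ a.carrier) a.2.2
  let m : Fin p → vectorSpan ℝ c.carrier := fun i => Submodule.inclusion hVac (e i)
  let γ := (o.or c).someVector
  let α := (o.or a).someVector
  have hα : α e ≠ 0 := (AlternatingMap.map_basis_ne_zero_iff e α).2 (o.or a).someVector_ne_zero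
  let D := contractTail γ m ⟨u, hu⟩ ⟨v, hv⟩
  have hD : D ≠ 0 := by
    have hdc : Module.finrank ℝ (vectorSpan ℝ c.carrier) = p + 2 := c.2.2
    refine contractTail_ne_zero hdc (o.or c).someVector_ne_zero fun w => ?_
    obtain ⟨s, t, hst⟩ := huv w w.2
    refine ⟨s, t, ?_⟩
    have hm : m = Submodule.inclusion hVac ∘ e := rfl
    rw [hm, Set.range_comp, Submodule.span_image, e.span_eq]
    exact ⟨⟨_, hst⟩, trivial, rfl⟩
  have hterm : ∀ i : ι, o.relOr c i.1 * o.relOr i.1 a =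
      Real.sign (f i (ellipse u v (θ i + Real.pi / 2))) * Real.sign (D * α e) := by
    intro i
    have hcoe : ∀ t, ((ellipse ⟨u, hu⟩ ⟨v, hv⟩ t : vectorSpan ℝ c.carrier) : V) =
        ellipse u v t := fun t => rfl
    obtain ⟨k, hk, h⟩ := o.exists_pos_relOr_mul_relOr i.2.1 i.2.2 (hf i) (hg i.1 i.2.2)
      (ellipse ⟨u, hu⟩ ⟨v, hv⟩ (θ i)) (ellipse ⟨u, hu⟩ ⟨v, hv⟩ (θ i + Real.pi / 2))
      (hθ1 i) (hθ2 i) (hne i) (o.or c).someVector_ne_zero (o.or c).someVector_ray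
      (o.or a).someVector_ne_zero (o.or a).someVector_ray e
    rw [contractTail_ellipse] at h
    change k * (o.relOr c i.1 * o.relOr i.1 a) * α e =
      Real.sign (f i (ellipse u v (θ i + Real.pi / 2))) * D at h
    have hr : o.relOr c i.1 * o.relOr i.1 a = 1 ∨ o.relOr c i.1 * o.relOr i.1 a = -1 := by
      rcases o.relOr_eq_one_or i.2.1 with h1 | h1 <;> rcases o.relOr_eq_one_or i.2.2 with h2 | h2 <;>
        simp [h1, h2]
    have hs : Real.sign (f i (ellipse u v (θ i + Real.pi / 2))) = 1 ∨
        Real.sign (f i (ellipse u v (θ i + Real.pi / 2))) = -1 :=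
      (Real.sign_apply_eq_of_ne_zero _ (hne i)).symm
    have hααpos : 0 < α e * α e := mul_self_pos.2 hα
    have h' : k * (o.relOr c i.1 * o.relOr i.1 a) * (α e * α e) =
      Real.sign (f i (ellipse u v (θ i + Real.pi / 2))) * (D * α e) := by
      linear_combination (α e) * h
    have hkα : 0 < k * (α e * α e) := mul_pos hk hααpos
    -- Both sides of the goal are `±1`, and `h'` makes a positive multiple of one agree in sign with
    -- the other.
    rcases lt_or_gt_of_ne (mul_ne_zero hD hα) with h0 | h0
    · rw [Real.sign_of_neg h0]
      rcases hr with hr | hr <;> rcases hs with hs | hs <;> rw [hr, hs] at h' ⊢ <;> nlinarith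
    · rw [Real.sign_of_pos h0]
      rcases hr with hr | hr <;> rcases hs with hs | hs <;> rw [hr, hs] at h' ⊢ <;> nlinarith
  rw [Finset.sum_congr rfl fun i _ => hterm i, ← Finset.sum_mul, hsign, zero_mul]

theorem Orient.bd_comp_bd (o : Orient K) (p : ℕ) : o.bd p ∘ₗ o.bd (p + 1) = 0 := by
  classical
  refine Finsupp.lhom_ext' fun c => LinearMap.ext_ring ?_
  ext a
  simp only [Orient.bd, LinearMap.comp_apply, Finsupp.lsingle_apply,
    Finsupp.linearCombination_single, one_smul, map_sum, LinearMap.zero_apply,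
    Finsupp.coe_zero, Pi.zero_apply, Finsupp.finsetSum_apply, Finsupp.smul_apply, smul_eq_mul]
  rw [← o.sum_relOr_mul_relOr c a]
  refine Finset.sum_congr rfl fun b _ => ?_
  simp [Finsupp.single_apply]

end Diamond

end Polytopal

namespace Polytopal

/-! ### Dimensions of subquotients. -/

section LinearAlgebra

variable {E F : Type*} [AddCommGroup E] [Module ℝ E] [AddCommGroup F] [Module ℝ F]

theorem Subquotient.finrank_add [FiniteDimensional ℝ E] {Z B : Submodule ℝ E} (h : B ≤ Z) :
    Module.finrank ℝ (Subquotient Z B) + Module.finrank ℝ B = Module.finrank ℝ Z := by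
  have := Submodule.finrank_quotient_add_finrank (B.submoduleOf Z)
  rwa [(Submodule.submoduleOfEquivOfLe h).finrank_eq] at this

instance [FiniteDimensional ℝ E] (Z B : Submodule ℝ E) : FiniteDimensional ℝ (Subquotient Z B) :=
  inferInstanceAs (FiniteDimensional ℝ (Z ⧸ B.submoduleOf Z))

theorem Subquotient.mk_eq_zero_iff {Z B : Submodule ℝ E} (z : Z) :
    Subquotient.mk Z B z = 0 ↔ (z : E) ∈ B :=
  Submodule.Quotient.mk_eq_zero (B.submoduleOf Z)

theorem Subquotient.mk_surjective (Z B : Submodule ℝ E) :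
    Function.Surjective (Subquotient.mk Z B) :=
  Submodule.mkQ_surjective _

/-- The pairing maps `Z₂` into the annihilator of `B₁` in the dual of `Z₁`, of dimension `dim Z₁ -
dim B₁`, with kernel inside `B₂`. -/
theorem Subquotient.finrank_le_of_pairing [FiniteDimensional ℝ E] [FiniteDimensional ℝ F]
    (β : E →ₗ[ℝ] F →ₗ[ℝ] ℝ) {Z₁ B₁ : Submodule ℝ E} {Z₂ B₂ : Submodule ℝ F}
    (h₁ : B₁ ≤ Z₁) (h₂ : B₂ ≤ Z₂) (hzero : ∀ σ ∈ B₁, ∀ τ ∈ Z₂, β σ τ = 0)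
    (hnd : ∀ τ ∈ Z₂, (∀ σ ∈ Z₁, β σ τ = 0) → τ ∈ B₂) :
    Module.finrank ℝ (Subquotient Z₂ B₂) ≤ Module.finrank ℝ (Subquotient Z₁ B₁) := by
  let φ : Z₂ →ₗ[ℝ] Module.Dual ℝ Z₁ := Z₁.subtype.dualMap ∘ₗ β.flip ∘ₗ Z₂.subtype
  have hφ : ∀ (τ : Z₂) (σ : Z₁), φ τ σ = β σ τ := fun _ _ => rfl
  have hker : LinearMap.ker φ ≤ B₂.submoduleOf Z₂ := fun τ hτ =>
    hnd τ τ.2 fun σ hσ => by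
      rw [← hφ τ ⟨σ, hσ⟩, LinearMap.mem_ker.1 hτ, LinearMap.zero_apply]
  have hrange : LinearMap.range φ ≤ (B₁.submoduleOf Z₁).dualAnnihilator := by
    rintro _ ⟨τ, rfl⟩
    rw [Submodule.mem_dualAnnihilator]
    exact fun σ hσ => hzero σ hσ τ τ.2
  have e1 := Submodule.finrank_mono hker
  have e2 := Submodule.finrank_mono hrange
  have e3 := Subspace.finrank_add_finrank_dualAnnihilator_eq (B₁.submoduleOf Z₁)
  have e4 := φ.finrank_range_add_finrank_ker
  have e5 := Subquotient.finrank_add h₁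
  have e6 := Subquotient.finrank_add h₂
  rw [(Submodule.submoduleOfEquivOfLe h₁).finrank_eq] at e3
  rw [(Submodule.submoduleOfEquivOfLe h₂).finrank_eq] at e1
  omega

end LinearAlgebra

/-! ### Fundamental class, pairing and harmonic cochains. -/

section Duality

variable {V P : Type*} [NormedAddCommGroup V] [NormedSpace ℝ V]
  [MetricSpace P] [NormedAddTorsor V P] {K : Mesh P} {o : Orient K}

theorem Orient.cobd_apply (p : ℕ) (σ : K.Cochain p) (x : K.Chain (p + 1)) :
    o.cobd p σ x = σ (o.bd p x) := rfl

theorem Orient.boundaries_le_cycles [FiniteDimensional ℝ V] (o : Orient K) :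
    ∀ p, o.boundaries p ≤ o.cycles p
  | 0 => le_top
  | p + 1 => by
    rintro _ ⟨x, rfl⟩
    exact LinearMap.congr_fun (o.bd_comp_bd p) x

theorem Orient.coboundaries_le_cocycles [FiniteDimensional ℝ V] (o : Orient K) :
    ∀ p, o.coboundaries p ≤ o.cocycles p
  | 0 => bot_le
  | p + 1 => by
    rintro _ ⟨σ, rfl⟩
    refine LinearMap.mem_ker.2 (LinearMap.ext fun x => ?_)
    rw [Orient.cobd_apply, Orient.cobd_apply]
    have := LinearMap.congr_fun (o.bd_comp_bd p) x
    rw [LinearMap.comp_apply, LinearMap.zero_apply] at this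
    rw [this, map_zero, LinearMap.zero_apply]

/-- Rank-nullity, since `∂` and its dual have the same rank. Degree 0 is separate because its cycles
and coboundaries are `⊤` and `⊥` by definition. -/
theorem Orient.finrank_cohomology [FiniteDimensional ℝ V] (o : Orient K) (p : ℕ) :
    Module.finrank ℝ (o.Cohomology p) = Module.finrank ℝ (o.Homology p) := by
  have e1 : Module.finrank ℝ (o.Cohomology p) + _ = _ :=
    Subquotient.finrank_add (o.coboundaries_le_cocycles p)
  have e2 : Module.finrank ℝ (o.Homology p) + _ = _ :=
    Subquotient.finrank_add (o.boundaries_le_cycles p)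
  have e3 := (o.cobd p).finrank_range_add_finrank_ker
  have e4 : Module.finrank ℝ (LinearMap.range (o.cobd p)) =
    Module.finrank ℝ (LinearMap.range (o.bd p)) := (o.bd p).finrank_range_dualMap_eq_finrank_range
  have e5 : Module.finrank ℝ (K.Cochain p) = Module.finrank ℝ (K.Chain p) :=
    Subspace.dual_finrank_eq
  change _ + _ = Module.finrank ℝ (LinearMap.ker (o.cobd p)) at e1
  change _ + Module.finrank ℝ (LinearMap.range (o.bd p)) = _ at e2
  cases p with
  | zero =>
    change _ + Module.finrank ℝ (⊥ : Submodule ℝ (K.Cochain 0)) = _ at e1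
    change _ = Module.finrank ℝ (⊤ : Submodule ℝ (K.Chain 0)) at e2
    rw [finrank_bot] at e1
    rw [finrank_top] at e2
    omega
  | succ p =>
    have e6 := (o.bd p).finrank_range_add_finrank_ker
    have e7 : Module.finrank ℝ (LinearMap.range (o.cobd p)) =
      Module.finrank ℝ (LinearMap.range (o.bd p)) :=
      (o.bd p).finrank_range_dualMap_eq_finrank_range
    change _ + Module.finrank ℝ (LinearMap.range (o.cobd p)) = _ at e1
    change _ = Module.finrank ℝ (LinearMap.ker (o.bd p)) at e2
    omega

/-- The fundamental class of a compatibly oriented closed mesh is a cycle. -/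
theorem Orient.bd_fundamentalClass {p : ℕ} (hK : K.IsClosedMesh (p + 1))
    (ho : o.IsCompatible (p + 1)) : o.bd p (K.fundamentalClass (p + 1)) = 0 := by
  classical
  have hsum : ∀ b : K.Cell p, ∑ c : K.Cell (p + 1), o.relOr c b = 0 := by
    intro b
    let s := {c : K.Cell (p + 1) | b.Face c}
    have hfin : s.Finite := Set.toFinite _
    -- The number of top cells at `b` is at most two; it is not zero because `b` lies in a top cell,
    -- and not one because the boundary is empty.
    have h0 : s.ncard ≠ 0 := by
      obtain ⟨c, hc⟩ := hK.exists_top p p.lt_succ_self b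
      rw [Ne, Set.ncard_eq_zero hfin, ← Ne, ← Set.nonempty_iff_ne_empty]
      exact ⟨c, hc⟩
    have h1 : s.ncard ≠ 1 := by
      intro h1
      have : b.carrier ∈ K.boundary (p + 1) := ⟨p, rfl, b, h1, Relation.ReflTransGen.refl⟩
      rw [hK.boundary_eq_empty] at this
      exact this
    have h2 : s.ncard ≤ 2 := hK.at_most_two p rfl b
    obtain ⟨c, c', hcc', hs⟩ := Set.ncard_eq_two.1 (show s.ncard = 2 by omega)
    have hface : ∀ e : K.Cell (p + 1), b.Face e → b.Hyperface e := fun e he =>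
      IsFace.isHyperface he ((congrArg (· + 1) b.2.2).trans e.2.2.symm)
    have hc : c ∈ s := by rw [hs]; simp
    have hc' : c' ∈ s := by rw [hs]; simp
    have hout : ∀ e ∈ Finset.univ, e ∉ ({c, c'} : Finset (K.Cell (p + 1))) → o.relOr e b = 0 := by
      intro e _ he
      refine o.relOr_of_not_hyperface fun h => he ?_
      have : e ∈ s := Relation.ReflTransGen.single h
      rw [hs] at this
      simpa using this
    rw [← Finset.sum_subset (Finset.subset_univ _) hout, Finset.sum_pair hcc',
      ho p rfl b c c' (hface c hc) (hface c' hc') hcc', neg_add_cancel]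
  ext b
  refine Eq.trans ?_ (hsum b)
  simp [Orient.bd, Mesh.fundamentalClass, Finsupp.finsetSum_apply, Finsupp.single_apply]

namespace CupProduct

variable (S : CupProduct o)

theorem pairing_apply {q p d : ℕ} (h : q + p = d) (σ : K.Cochain q) (τ : K.Cochain p) :
    S.pairing h σ τ = S.cup q p d h σ τ (K.fundamentalClass d) := rfl

/-- `δμ ⌣ τ = δ(μ ⌣ τ)` for closed `τ`, and its value on `[K]` is that of `μ ⌣ τ` on `∂[K] = 0`. -/
theorem pairing_coboundary_cocycle {q p d : ℕ} (h : q + p = d) (hK : K.IsClosedMesh d)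
    (ho : o.IsCompatible d) {σ : K.Cochain q} (hσ : σ ∈ o.coboundaries q) {τ : K.Cochain p}
    (hτ : τ ∈ o.cocycles p) : S.pairing h σ τ = 0 := by
  cases q with
  | zero =>
    have : σ = 0 := hσ
    rw [this, map_zero, LinearMap.zero_apply]
  | succ q =>
    obtain ⟨μ, rfl⟩ := hσ
    obtain ⟨n, hn⟩ : ∃ n, q + p = n := ⟨_, rfl⟩
    obtain rfl : d = n + 1 := by omega
    have h1 := S.leibniz q p n hn μ τ
    rw [LinearMap.mem_ker.1 hτ, map_zero, smul_zero, add_zero] at h1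
    rw [pairing_apply, ← h1, Orient.cobd_apply, Orient.bd_fundamentalClass hK ho, map_zero]

theorem pairing_cocycle_coboundary {q p d : ℕ} (h : q + p = d) (hK : K.IsClosedMesh d)
    (ho : o.IsCompatible d) {σ : K.Cochain q} (hσ : σ ∈ o.cocycles q) {τ : K.Cochain p}
    (hτ : τ ∈ o.coboundaries p) : S.pairing h σ τ = 0 := by
  cases p with
  | zero =>
    have : τ = 0 := hτ
    rw [this, map_zero]
  | succ p =>
    obtain ⟨μ, rfl⟩ := hτ
    obtain ⟨n, hn⟩ : ∃ n, q + p = n := ⟨_, rfl⟩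
    obtain rfl : d = n + 1 := by omega
    have h1 := S.leibniz q p n hn σ μ
    rw [LinearMap.mem_ker.1 hσ, map_zero, LinearMap.zero_apply, zero_add] at h1
    have h2 := LinearMap.congr_fun h1 (K.fundamentalClass (n + 1))
    rw [Orient.cobd_apply, Orient.bd_fundamentalClass hK ho, map_zero, LinearMap.smul_apply,
      smul_eq_mul] at h2
    exact (mul_eq_zero.1 h2.symm).resolve_left (pow_ne_zero _ (by norm_num))

theorem NondegenerateOnCohomology.finrank_eq [FiniteDimensional ℝ V] {S : CupProduct o} {d : ℕ}
    (hS : S.NondegenerateOnCohomology d) (hK : K.IsClosedMesh d) (ho : o.IsCompatible d)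
    {q p : ℕ} (h : q + p = d) :
    Module.finrank ℝ (o.Cohomology p) = Module.finrank ℝ (o.Cohomology q) :=
  le_antisymm
    (Subquotient.finrank_le_of_pairing (S.pairing h) (o.coboundaries_le_cocycles q)
      (o.coboundaries_le_cocycles p)
      (fun _ hσ _ hτ => S.pairing_coboundary_cocycle h hK ho hσ hτ) (hS q p h).1)
    (Subquotient.finrank_le_of_pairing (S.pairing h).flip (o.coboundaries_le_cocycles p)
      (o.coboundaries_le_cocycles q)
      (fun _ hτ _ hσ => S.pairing_cocycle_coboundary h hK ho hσ hτ) (hS q p h).2)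

end CupProduct

namespace CochainInner

variable (g : CochainInner K)

theorem inner_self_nonneg (p : ℕ) (σ : K.Cochain p) : 0 ≤ g.inner p σ σ := by
  by_cases h : σ = 0
  · simp [h]
  · exact (g.pos p σ h).le

theorem eq_zero_of_inner_self {p : ℕ} {σ : K.Cochain p} (h : g.inner p σ σ = 0) : σ = 0 := by
  by_contra hσ
  exact (g.pos p σ hσ).ne' h

theorem restrict_nondegenerate (p : ℕ) (W : Submodule ℝ (K.Cochain p)) :
    ((g.inner p).restrict W).Nondegenerate := by
  constructor
  · exact fun σ h => Subtype.ext (g.eq_zero_of_inner_self (h σ))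
  · exact fun σ h => Subtype.ext (g.eq_zero_of_inner_self (h σ))

/-- A cochain is harmonic if and only if it is closed and orthogonal to the coboundaries. -/
theorem mem_harmonic_iff (o : Orient K) {r : ℕ} {τ : K.Cochain r} :
    τ ∈ g.harmonic o r ↔
      τ ∈ o.cocycles r ∧ ∀ β ∈ o.coboundaries r, g.inner r β τ = 0 := by
  unfold harmonic
  rw [LinearMap.mem_ker]
  cases r with
  | zero =>
    change g.adjCobd o 0 (o.cobd 0 τ) = 0 ↔ _
    constructor
    · intro h
      refine ⟨g.eq_zero_of_inner_self ?_, fun β hβ => ?_⟩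
      · rw [g.inner_adjCobd, h, map_zero]
      · rw [show β = 0 from hβ, map_zero, LinearMap.zero_apply]
    · rintro ⟨h, -⟩
      rw [show o.cobd 0 τ = 0 from h, map_zero]
  | succ r =>
    change o.cobd r (g.adjCobd o r τ) + g.adjCobd o (r + 1) (o.cobd (r + 1) τ) = 0 ↔ _
    constructor
    · intro h
      -- Pairing `Δτ = 0` with `τ` gives `⟨δ⋆τ, δ⋆τ⟩ + ⟨δτ, δτ⟩ = 0`, so both terms vanish.
      have h1 := congrArg (g.inner (r + 1) τ) h
      rw [map_add, map_zero, ← g.inner_adjCobd, g.symm (r + 1), g.inner_adjCobd] at h1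
      have h2 := g.inner_self_nonneg r (g.adjCobd o r τ)
      have h3 := g.inner_self_nonneg (r + 1 + 1) (o.cobd (r + 1) τ)
      have h4 : g.adjCobd o r τ = 0 := g.eq_zero_of_inner_self (by linarith)
      refine ⟨g.eq_zero_of_inner_self (by linarith), ?_⟩
      rintro _ ⟨μ, rfl⟩
      rw [g.inner_adjCobd, h4, map_zero]
    · rintro ⟨h, h'⟩
      have h1 : g.adjCobd o r τ = 0 := g.eq_zero_of_inner_self <| by
        rw [← g.inner_adjCobd]
        exact h' _ ⟨_, rfl⟩
      rw [show o.cobd (r + 1) τ = 0 from h, h1, map_zero, map_zero, add_zero]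

theorem harmonic_le_cocycles (o : Orient K) (r : ℕ) : g.harmonic o r ≤ o.cocycles r :=
  fun _ h => ((g.mem_harmonic_iff o).1 h).1

theorem eq_zero_of_mem_harmonic_of_mem_coboundaries {r : ℕ} {τ : K.Cochain r}
    (h : τ ∈ g.harmonic o r) (h' : τ ∈ o.coboundaries r) : τ = 0 :=
  g.eq_zero_of_inner_self (((g.mem_harmonic_iff o).1 h).2 τ h')

/-- Split off the orthogonal projection to the coboundaries; the remainder stays closed because
coboundaries are. -/
theorem exists_harmonic_sub_mem_coboundaries [FiniteDimensional ℝ V] {r : ℕ} {σ : K.Cochain r}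
    (hσ : σ ∈ o.cocycles r) : ∃ τ ∈ g.harmonic o r, σ - τ ∈ o.coboundaries r := by
  have hc := LinearMap.BilinForm.isCompl_orthogonal_of_restrict_nondegenerate
    (B := g.inner r) (W := o.coboundaries r)
    (fun a b h => by rw [g.symm]; exact h) (g.restrict_nondegenerate r _)
  obtain ⟨β, hβ, τ, hτ, rfl⟩ := Submodule.mem_sup.1 (hc.sup_eq_top ▸ Submodule.mem_top :
    σ ∈ o.coboundaries r ⊔ (g.inner r).orthogonal (o.coboundaries r))
  refine ⟨τ, (g.mem_harmonic_iff o).2 ⟨?_, fun β' hβ' => hτ β' hβ'⟩, by simpa using hβ⟩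
  exact (Submodule.add_mem_iff_right _ (o.coboundaries_le_cocycles r hβ)).1 hσ

theorem bijective_harmonic [FiniteDimensional ℝ V] (o : Orient K) (r : ℕ) : Function.Bijective
    (Subquotient.mk (o.cocycles r) (o.coboundaries r) ∘ₗ
      Submodule.inclusion (g.harmonic_le_cocycles o r)) := by
  constructor
  · refine (injective_iff_map_eq_zero _).2 fun τ hτ => ?_
    rw [LinearMap.comp_apply, Subquotient.mk_eq_zero_iff] at hτ
    exact Subtype.ext (g.eq_zero_of_mem_harmonic_of_mem_coboundaries τ.2 hτ)
  · intro x
    obtain ⟨σ, rfl⟩ := Subquotient.mk_surjective _ _ x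
    obtain ⟨τ, hτ, hστ⟩ := g.exists_harmonic_sub_mem_coboundaries σ.2
    refine ⟨⟨τ, hτ⟩, ?_⟩
    rw [LinearMap.comp_apply, eq_comm, ← sub_eq_zero, ← map_sub, Subquotient.mk_eq_zero_iff]
    exact hστ

theorem finrank_harmonic [FiniteDimensional ℝ V] (o : Orient K) (r : ℕ) :
    Module.finrank ℝ (g.harmonic o r) = Module.finrank ℝ (o.Cohomology r) :=
  (LinearEquiv.ofBijective _ (g.bijective_harmonic o r)).finrank_eq

/-- The Hodge star followed by the orthogonal projection, on harmonic cochains. -/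
noncomputable def harmonicStar (S : CupProduct o) {q p d : ℕ} (h : q + p = d) :
    g.harmonic o p →ₗ[ℝ] g.harmonic o q :=
  (LinearMap.BilinForm.toDual (K := ℝ) (V := g.harmonic o q)
      ((g.inner q).restrict (g.harmonic o q)) (g.restrict_nondegenerate q _)).symm.toLinearMap ∘ₗ
    (g.harmonic o q).subtype.dualMap ∘ₗ (S.pairing h).flip ∘ₗ (g.harmonic o p).subtype

/-- Together with `inner_star`, this identifies `harmonicStar` with the orthogonal projection of the
Hodge star. -/
theorem inner_harmonicStar (S : CupProduct o) {q p d : ℕ} (h : q + p = d)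
    (σ : g.harmonic o q) (τ : g.harmonic o p) :
    g.inner q σ (g.harmonicStar S h τ) = S.pairing h σ τ := by
  have h' : ((g.inner q).restrict (g.harmonic o q)).toDual (g.restrict_nondegenerate q _)
      (g.harmonicStar S h τ) σ = S.pairing h σ τ := by
    simp [harmonicStar]
  rw [g.symm q]
  exact h'

/-- If the image of `τ` is zero, `τ` pairs to zero with harmonic cochains, hence with all cocycles,
as these differ from harmonic ones by coboundaries. Nondegeneracy makes `τ` a coboundary, and a
harmonic coboundary is zero. -/
theorem injective_harmonicStar [FiniteDimensional ℝ V] {S : CupProduct o} {q p d : ℕ}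
    (hS : S.NondegenerateOnCohomology d)
    (hK : K.IsClosedMesh d) (ho : o.IsCompatible d) (h : q + p = d) :
    Function.Injective (g.harmonicStar S h) := by
  refine (injective_iff_map_eq_zero _).2 fun τ hτ => ?_
  have hτc := g.harmonic_le_cocycles o p τ.2
  refine Subtype.ext (g.eq_zero_of_mem_harmonic_of_mem_coboundaries τ.2
    ((hS q p h).1 τ hτc fun σ hσ => ?_))
  obtain ⟨ρ, hρ, hσρ⟩ := g.exists_harmonic_sub_mem_coboundaries hσ
  have h1 := S.pairing_coboundary_cocycle h hK ho hσρ hτc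
  have h2 := g.inner_harmonicStar S h ⟨ρ, hρ⟩ τ
  rw [hτ, Submodule.coe_zero, map_zero] at h2
  rw [map_sub, LinearMap.sub_apply, sub_eq_zero] at h1
  rw [h1, h2]

end CochainInner

end Duality

end Polytopal

theorem mainTheorem6 {V P : Type*} [NormedAddCommGroup V] [NormedSpace ℝ V]
    [FiniteDimensional ℝ V] [MetricSpace P] [NormedAddTorsor V P]
    (d : ℕ) (K : Polytopal.Mesh P) (hK : K.IsClosedMesh d)
    (o : Polytopal.Orient K) (ho : o.IsCompatible d)
    (S : Polytopal.CupProduct o) (hS : S.NondegenerateOnCohomology d)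
    (q p : ℕ) (hqp : q + p = d) :
    Nonempty (o.Cohomology p ≃ₗ[ℝ] o.Homology q) ∧
    Nonempty (o.Cohomology q ≃ₗ[ℝ] o.Homology q) ∧
    ∀ g : Polytopal.CochainInner K,
      (∀ r : ℕ, ∃ hr : g.harmonic o r ≤ o.cocycles r, Function.Bijective
        (Polytopal.Subquotient.mk (o.cocycles r) (o.coboundaries r) ∘ₗ Submodule.inclusion hr)) ∧
      ∃ s : g.harmonic o p ≃ₗ[ℝ] g.harmonic o q,
        ∀ (τ : g.harmonic o p) (σ : g.harmonic o q),
          g.inner q (σ : K.Cochain q) (g.star S hqp τ - s τ) = 0 := by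
  have hpq := hS.finrank_eq hK ho hqp
  have hfin : ∀ g : Polytopal.CochainInner K,
      Module.finrank ℝ (g.harmonic o p) = Module.finrank ℝ (g.harmonic o q) := fun g => by
    rw [g.finrank_harmonic, g.finrank_harmonic, hpq]
  refine ⟨⟨LinearEquiv.ofFinrankEq _ _ (hpq.trans (o.finrank_cohomology q))⟩,
    ⟨LinearEquiv.ofFinrankEq _ _ (o.finrank_cohomology q)⟩, fun g =>
    ⟨fun r => ⟨g.harmonic_le_cocycles o r, g.bijective_harmonic o r⟩,
      LinearEquiv.ofBijective (g.harmonicStar S hqp) ⟨g.injective_harmonicStar hS hK ho hqp,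
        (LinearMap.injective_iff_surjective_of_finrank_eq_finrank (K := ℝ)
          (V := g.harmonic o p) (V₂ := g.harmonic o q) (hfin g)).1
          (g.injective_harmonicStar hS hK ho hqp)⟩, fun τ σ => ?_⟩⟩
  rw [map_sub, g.inner_star, sub_eq_zero]
  exact (g.inner_harmonicStar S hqp σ τ).symm
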